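/- Let $(S_n)_{n\in\mathbb Z}$ and $(T_n)_{n\in\mathbb Z}$ be the solutions of the Somos-5 recurrence $\tau_{n+5}\tau_n=\tau_{n+4}\tau_{n+1}+\tau_{n+3}\tau_{n+2}$ with $(S_0,\dots,S_4)=(1,1,1,2,3)$, $S_{-n}=S_n$, and $T_0=0$, $(T_1,\dots,T_5)=(1,-1,1,1,-7)$, $T_{-n}=-T_n$, and put $f_n=S_n/T_n\in\mathbb P^1(\mathbb Q)$. Then $T_n\neq 0$ for $n\ne 0$, so $f_n$ is finite for $n\neq 0$, while $f_0=\infty$, and the following hold. (i) There are a lattice $\Lambda\subset\mathbb C$ with invariants $g_2=\frac{121}{72}$, $g_3=-\frac{845}{1296\sqrt6}$, a half-period $\omega$ of $\Lambda$ (that is, $\omega\notin\Lambda$ and $2\omega\in\Lambda$) with $\wp(\omega)=\frac{5}{12\sqrt6}$, $\wp'(\omega)=0$, and $\kappa\in\mathbb C$ with $\wp(\kappa)=\frac{29}{12\sqrt6}$, $\wp'(\kappa)=6^{1/4}$. For any such $\Lambda,\omega,\kappa$, with $\sigma,\zeta$ the Weierstrass functions of $\Lambda$, $\eta=\zeta(\omega)$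 and $$\Phi(z)=\frac{\sigma(z+\omega)e^{-\eta z}}{\sigma(\omega)\sigma(z)},$$ one has $n\kappa\notin\Lambda$ for every integer $n\neq 0$, $\Phi(\kappa)\ne0$, $\Phi(2\kappa)\neq0$, and, for all $n\ne0$, $$f_n=\begin{cases}-\Phi(n\kappa)/\Phi(2\kappa), & n\text{ even},\\ \Phi(n\kappa)/\Phi(\kappa), & n\text{ odd};\end{cases}$$ for $n=0$ both sides are infinite, that is, $\Phi(z)\to\infty$ as $z\to0$. (ii) For all $n\in\mathbb Z$, $$f_{n+1}f_{n-1}=\begin{cases}(1+f_n^2)/(2-f_n^2), & n\text{ even},\\ (1+2f_n^2)/(1-f_n^2), & n\text{ odd}.\end{cases}$$ For even $n\ne0$ and for odd $n\neq\pm1$ this is an equation between rational numbers with nonzero denominators; for every $n$ it holds in $\mathbb P^1(\mathbb Q)$, both sides being written as ratios of polynomials in the homogeneous coordinates $f_m=[S_m:T_m]$. (iii) For all $j\in\mathbb Z$ the points $(W,Z)=(f_{2j\pm1},f_{2j})$ lie on the biquadratic curve $$(1-W^2)Z^2+3WZ+2W^2+1=0$$ (for $j=0$, on the curve in $\mathbb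 P^1\times\mathbb P^1$ given by the corresponding bihomogeneous equation). (iv) These points form an orbit of a QRT map. In the pencil $(1-W^2)Z^2+JWZ+2W^2+1=0$ in $\mathbb P^1\times\mathbb P^1$, let the horizontal switch $\iota_h$ (respectively the vertical switch $\iota_v$) replace a point of the member of parameter $J$ by the other intersection point of that member with the horizontal (respectively vertical) line through the point, and let $\varphi=\iota_v\circ\iota_h$ be the QRT map. On the member $J=3$, for all $j\in\mathbb Z$: $\iota_h(f_{2j-1},f_{2j})=(f_{2j+1},f_{2j})$, $\iota_v(f_{2j+1},f_{2j})=(f_{2j+1},f_{2j+2})$, and hence $\varphi(f_{2j-1},f_{2j})=(f_{2j+1},f_{2j+2})$. -/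

import Mathlib

open Filter Topology

noncomputable section

/-- The terms of index `n ≥ 0` of the Somos-5 sequence `1, 1, 1, 2, 3, 5, 11, 37, 83, 274, …`. -/
def somosSNat : ℕ → ℚ
  | 0 => 1
  | 1 => 1
  | 2 => 1
  | 3 => 2
  | 4 => 3
  | n + 5 =>
    (somosSNat (n + 4) * somosSNat (n + 1) + somosSNat (n + 3) * somosSNat (n + 2)) / somosSNat n

/-- The terms of index `n ≥ 0` of the Somos-5 sequence `0, 1, -1, 1, 1, -7, 8, -1, -57, 391, …`.
The initial data are the terms of index `1, …, 5`, because the term of index `0` vanishes. -/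
def somosTNat : ℕ → ℚ
  | 0 => 0
  | 1 => 1
  | 2 => -1
  | 3 => 1
  | 4 => 1
  | 5 => -7
  | n + 6 =>
    (somosTNat (n + 5) * somosTNat (n + 2) + somosTNat (n + 4) * somosTNat (n + 3)) /
      somosTNat (n + 1)

/-- `S n` for `n ∈ ℤ`, extended by `S (-n) = S n`. -/
def somosS (n : ℤ) : ℚ := somosSNat n.natAbs

/-- `T n` for `n ∈ ℤ`, extended by `T (-n) = -T n`. -/
def somosT (n : ℤ) : ℚ := n.sign * somosTNat n.natAbs

/-- The ratio `f n = S n / T n` as a rational number, for `n ≠ 0`. -/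
def somosRatio (n : ℤ) : ℚ := somosS n / somosT n

/-- The ratio `f n = S n / T n` as a point of `ℙ¹(ℚ) = ℚ ∪ {∞}`, for every `n` (so `f 0 = ∞`). -/
def somosRatioP (n : ℤ) : OnePoint ℚ :=
  open Classical in
  if somosT n = 0 then OnePoint.infty else ((somosS n / somosT n : ℚ) : OnePoint ℚ)

/-- `[a : b]` and `[c : d]` are the same point of the projective line. -/
def SameProjPoint (a b c d : ℚ) : Prop :=
  (a ≠ 0 ∨ b ≠ 0) ∧ (c ≠ 0 ∨ d ≠ 0) ∧ a * d = b * c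

/-- Homogeneous coordinates `[x₀ : x₁]` of a point of `ℙ¹(ℚ) = ℚ ∪ {∞}`:
`∞ = [1 : 0]` and `x = [x : 1]`. -/
def projCoords : OnePoint ℚ → ℚ × ℚ
  | none => (1, 0)
  | some x => (x, 1)

/-! The pencil of biquadratic curves `(1 - W²) Z² + J W Z + 2 W² + 1 = 0` in `ℙ¹ × ℙ¹`,
with parameter `J`. -/

/-- The curve of parameter `J` in `ℙ¹ × ℙ¹`, by its bihomogeneous equation. -/
def OnBiquadratic (J : ℚ) (P : OnePoint ℚ × OnePoint ℚ) : Prop :=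
  let w := projCoords P.1
  let z := projCoords P.2
  (w.2 ^ 2 - w.1 ^ 2) * z.1 ^ 2 + J * (w.1 * w.2) * (z.1 * z.2)
    + (2 * w.1 ^ 2 + w.2 ^ 2) * z.2 ^ 2 = 0

/-- If `x ∈ ℙ¹` is a root of the nonzero quadratic form `A X² + B X Y + C Y²`, this is its other
root (equal to `x` when `x` is a double root), by Vieta's formulas. -/
def otherRoot (A B C : ℚ) : OnePoint ℚ → OnePoint ℚ
  | none => open Classical in
      if B = 0 then OnePoint.infty else ((-C / B : ℚ) : OnePoint ℚ)
  | some x => open Classical in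
      if A = 0 then OnePoint.infty else ((-B / A - x : ℚ) : OnePoint ℚ)

/-- The horizontal switch `(W, Z) ↦ (W†, Z)` on the curve of parameter `J`: `(W†, Z)` is the other
point of intersection of the curve with the horizontal line through `(W, Z)`. The equation is
`(2 - Z²) W² + J Z W + (1 + Z²) = 0` as a quadratic in `W`. -/
def switchH (J : ℚ) (P : OnePoint ℚ × OnePoint ℚ) : OnePoint ℚ × OnePoint ℚ :=
  let z := projCoords P.2
  (otherRoot (2 * z.2 ^ 2 - z.1 ^ 2) (J * (z.1 * z.2)) (z.1 ^ 2 + z.2 ^ 2) P.1, P.2)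

/-- The vertical switch `(W, Z) ↦ (W, Z†)` on the curve of parameter `J`: `(W, Z†)` is the other
point of intersection of the curve with the vertical line through `(W, Z)`. -/
def switchV (J : ℚ) (P : OnePoint ℚ × OnePoint ℚ) : OnePoint ℚ × OnePoint ℚ :=
  let w := projCoords P.1
  (P.1, otherRoot (w.2 ^ 2 - w.1 ^ 2) (J * (w.1 * w.2)) (2 * w.1 ^ 2 + w.2 ^ 2) P.2)

/-- The QRT map of the pencil, on its member of parameter `J`: the horizontal switch followed by
the vertical switch. -/
def qrtMap (J : ℚ) (P : OnePoint ℚ × OnePoint ℚ) : OnePoint ℚ × OnePoint ℚ :=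
  switchV J (switchH J P)

/-- The Weierstrass sigma function
`σ(z) = z ∏_{l ≠ 0} (1 - z / l) exp (z / l + z² / (2 l²))` of a lattice.
The factor with `l = 0` equals `1` in Lean, so it may be left in the product. -/
def PeriodPair.sigmaFun (L : PeriodPair) (z : ℂ) : ℂ :=
  z * ∏' l : L.lattice,
    (1 - z / (l : ℂ)) * Complex.exp (z / (l : ℂ) + z ^ 2 / (2 * (l : ℂ) ^ 2))

/-- The Weierstrass zeta function
`ζ(z) = 1 / z + ∑_{l ≠ 0} (1 / (z - l) + 1 / l + z / l²)` of a lattice.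
The term with `l = 0` equals `1 / z` in Lean, so it is part of the sum. -/
def PeriodPair.zetaFun (L : PeriodPair) (z : ℂ) : ℂ :=
  ∑' l : L.lattice, (1 / (z - (l : ℂ)) + 1 / (l : ℂ) + z / (l : ℂ) ^ 2)

/-- `Φ(z) = σ(z + ω) e^{-η z} / (σ(ω) σ(z))` with `η = ζ(ω)`. -/
def PeriodPair.PhiFun (L : PeriodPair) (ω z : ℂ) : ℂ :=
  L.sigmaFun (z + ω) * Complex.exp (-(L.zetaFun ω) * z) / (L.sigmaFun ω * L.sigmaFun z)

/-- The period lattice of `y² = 4 x³ - g₂ x - g₃` with `g₂ = 121/72`, `g₃ = -845/(1296 √6)`, its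
half-period `ω` with `℘(ω) = 5/(12 √6)`, and `κ` with
`(℘(κ), ℘'(κ)) = (29/(12 √6), 6^{1/4})`. This determines the lattice, and `ω` and `κ` modulo the
lattice. -/
structure IsSomosLattice (L : PeriodPair) (ω κ : ℂ) : Prop where
  g₂_eq : L.g₂ = 121 / 72
  g₃_eq : L.g₃ = -845 / (1296 * ((√6 : ℝ) : ℂ))
  ω_notMem : ω ∉ L.lattice
  two_mul_ω_mem : 2 * ω ∈ L.lattice
  weierstrassP_ω : L.weierstrassP ω = 5 / (12 * ((√6 : ℝ) : ℂ))
  derivWeierstrassP_ω : L.derivWeierstrassP ω = 0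
  weierstrassP_κ : L.weierstrassP κ = 29 / (12 * ((√6 : ℝ) : ℂ))
  derivWeierstrassP_κ : L.derivWeierstrassP κ = (((6 : ℝ) ^ (1 / 4 : ℝ) : ℝ) : ℂ)

end

/-! Both sequences are defined by division, so everything depends on `T n ≠ 0` for `n ≠ 0`. This
rational statement is proved on an elliptic curve.

Put x(z) = √6 (℘(z) − ℘(ω)) = √6 Φ(z)². Then 6√6 ℘'² = x(4x² + 5x − 8), with x(κ) = 2 and x(2κ) = 1.
Factoring ℘(u) − ℘(v) into sigma functions and translating by ω gives the addition formula 3 Φ(u+κ)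
Φ(u−κ) (2 − x(u)) = √6 (x(u) + 1). Hence the normalised values of Φ(nκ), whose squares are x(nκ) for
even n and x(nκ)/2 for odd n, satisfy the multiplicative recurrence of the ratios
(`IsSomosLattice.isSomosRatio`).

For the sequences this recurrence splits into separate three-term relations for S and T (`EvenStep`,
`OddStep`). Together with the biquadratic relation they imply Somos-5 (`CurveRel.somosFive`), so
Somos-5 propagates them. If T vanished at n + 1, they would give x(nκ) = 2 = x(κ), so (n+1)κ or
(n−1)κ would be a period. But κ has infinite order: x(2^k · 6κ) has 2-adic valuation −2(k+3)
(`exists_odd_somosX`), whereas a torsion point has finitely many multiples. One induction,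
`IsSomosRatio.somos`, yields nonvanishing, the relations and the analytic formula together.

The two neighbours of a ratio are the two roots of the biquadratic with that ratio fixed: the
three-term relations give the product of the roots, the `cross` lemmas their sum. This is the action
of the QRT switches. The lattice itself exists because E₆²/E₄³ takes every value in (0, 1) on the
imaginary axis. -/

/-! ### Weierstrass primary factors. -/

/-- The primary factor of genus two `(1 - w) exp (w + w² / 2)`. -/
noncomputable def primaryFactor (w : ℂ) : ℂ := (1 - w) * Complex.exp (w + w ^ 2 / 2)

lemma hasDerivAt_primaryFactor (w : ℂ) :
    HasDerivAt primaryFactor (-w ^ 2 * Complex.exp (w + w ^ 2 / 2)) w := by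
  have h1 : HasDerivAt (fun w : ℂ ↦ 1 - w) (-1) w := by
    simpa using (hasDerivAt_id w).const_sub 1
  have h2 : HasDerivAt (fun w : ℂ ↦ w + w ^ 2 / 2) (1 + w) w := by
    convert! (hasDerivAt_id w).add ((hasDerivAt_pow 2 w).div_const 2) using 1
    simp
  convert! h1.mul h2.cexp using 1
  ring

lemma differentiable_primaryFactor : Differentiable ℂ primaryFactor :=
  fun w ↦ (hasDerivAt_primaryFactor w).differentiableAt

/-- The derivative −w² exp(w + w²/2) is quadratically small, so the mean value inequality gives a
cubic bound. Cubic decay is what makes the product over a lattice of rank two converge. -/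
lemma norm_primaryFactor_sub_one_le {w : ℂ} (hw : ‖w‖ ≤ 1 / 2) :
    ‖primaryFactor w - 1‖ ≤ 3 * ‖w‖ ^ 3 := by
  have key : ∀ x ∈ Metric.closedBall (0 : ℂ) ‖w‖,
      ‖-x ^ 2 * Complex.exp (x + x ^ 2 / 2)‖ ≤ 3 * ‖w‖ ^ 2 := by
    intro x hx
    have hx : ‖x‖ ≤ ‖w‖ := by simpa using hx
    have h1 : ‖x + x ^ 2 / 2‖ ≤ 1 := by
      calc ‖x + x ^ 2 / 2‖ ≤ ‖x‖ + ‖x ^ 2 / 2‖ := norm_add_le _ _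
        _ = ‖x‖ + ‖x‖ ^ 2 / 2 := by simp
        _ ≤ 1 := by nlinarith [norm_nonneg x]
    have h2 : ‖Complex.exp (x + x ^ 2 / 2)‖ ≤ 3 := by
      refine (Complex.norm_exp_le_exp_norm _).trans ((Real.exp_le_exp.mpr h1).trans ?_)
      exact Real.exp_one_lt_d9.le.trans (by norm_num)
    calc ‖-x ^ 2 * Complex.exp (x + x ^ 2 / 2)‖ = ‖x‖ ^ 2 * ‖Complex.exp (x + x ^ 2 / 2)‖ := by simp
      _ ≤ ‖w‖ ^ 2 * 3 := by gcongr
      _ = _ := by ring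
  have := (convex_closedBall (0 : ℂ) ‖w‖).norm_image_sub_le_of_norm_hasDerivWithin_le
    (fun x _ ↦ (hasDerivAt_primaryFactor x).hasDerivWithinAt) key (x := 0) (y := w)
    (by simp) (by simp)
  have h0 : primaryFactor 0 = 1 := by simp [primaryFactor]
  rw [h0, sub_zero] at this
  exact this.trans_eq (by ring)

lemma primaryFactor_eq_zero_iff {w : ℂ} : primaryFactor w = 0 ↔ w = 1 := by
  rw [primaryFactor, mul_eq_zero, or_iff_left (Complex.exp_ne_zero _), sub_eq_zero, eq_comm]

lemma logDeriv_primaryFactor {w : ℂ} (hw : w ≠ 1) :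
    logDeriv primaryFactor w = 1 / (w - 1) + 1 + w := by
  rw [logDeriv_apply, (hasDerivAt_primaryFactor w).deriv, primaryFactor]
  have h1 : w - 1 ≠ 0 := sub_ne_zero.mpr hw
  have h2 : 1 - w ≠ 0 := sub_ne_zero.mpr hw.symm
  have h3 := Complex.exp_ne_zero (w + w ^ 2 / 2)
  field_simp
  ring

/-! ### The sigma and zeta functions: convergence, zeros, quasi-periodicity. -/

namespace PeriodPair

variable (L : PeriodPair)

/-- The product over the lattice in the definition of the sigma function, without the factor `z`. -/
noncomputable def sigmaProd (z : ℂ) : ℂ := ∏' l : L.lattice, primaryFactor (z / l)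

lemma sigmaFun_eq (z : ℂ) : L.sigmaFun z = z * L.sigmaProd z := by
  simp only [sigmaFun, sigmaProd, primaryFactor]
  congr! 4
  ring_nf

lemma lattice_bound (r : ℝ) : ∀ᶠ l : L.lattice in cofinite, 2 * r ≤ ‖(l : ℂ)‖ := by
  have : Tendsto (fun l : L.lattice ↦ ‖l‖) cofinite atTop := by
    rw [← cocompact_eq_cofinite]
    exact tendsto_norm_cocompact_atTop
  exact this.eventually_ge_atTop (2 * r)

lemma summable_sigma_bound (r : ℝ) :
    Summable fun l : L.lattice ↦ 3 * r ^ 3 * ‖(l : ℂ)‖ ^ (-3 : ℝ) :=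
  (ZLattice.summable_norm_rpow L.lattice _ (by simp; norm_num)).mul_left _

lemma primaryFactor_bound {r : ℝ} (hr : 0 < r) :
    ∀ᶠ l : L.lattice in cofinite, ∀ z ∈ Metric.ball (0 : ℂ) r,
      ‖primaryFactor (z / l) - 1‖ ≤ 3 * r ^ 3 * ‖(l : ℂ)‖ ^ (-3 : ℝ) := by
  filter_upwards [L.lattice_bound r] with l hl z hz
  have hz : ‖z‖ < r := by simpa using hz
  have hl0 : 0 < ‖(l : ℂ)‖ := by linarith
  have hw : ‖z / l‖ ≤ 1 / 2 := by
    rw [norm_div, div_le_div_iff₀ hl0 two_pos]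
    linarith
  refine (norm_primaryFactor_sub_one_le hw).trans ?_
  rw [norm_div, div_pow, mul_assoc, Real.rpow_neg hl0.le, div_eq_mul_inv]
  norm_cast
  gcongr

lemma hasProdLocallyUniformlyOn_sigmaProd {r : ℝ} (hr : 0 < r) :
    HasProdLocallyUniformlyOn (fun (l : L.lattice) z ↦ primaryFactor (z / l)) L.sigmaProd
      (Metric.ball 0 r) := by
  have := Summable.hasProdLocallyUniformlyOn_one_add (K := Metric.ball (0 : ℂ) r)
    (f := fun (l : L.lattice) z ↦ primaryFactor (z / l) - 1) Metric.isOpen_ball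
    (L.summable_sigma_bound r) (L.primaryFactor_bound hr) (fun l ↦ by
      have := differentiable_primaryFactor.continuous
      fun_prop)
  simpa [sigmaProd] using! this

lemma differentiable_sigmaProd : Differentiable ℂ L.sigmaProd := by
  intro z
  have hr : 0 < ‖z‖ + 1 := by positivity
  have h := (L.hasProdLocallyUniformlyOn_sigmaProd hr)
  rw [hasProdLocallyUniformlyOn_iff_tendstoLocallyUniformlyOn] at h
  refine (h.differentiableOn (.of_forall fun s ↦ ?_) Metric.isOpen_ball).differentiableAt
    (Metric.isOpen_ball.mem_nhds (by simp))
  have := differentiable_primaryFactor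
  fun_prop

lemma differentiable_sigmaFun : Differentiable ℂ L.sigmaFun := by
  have := L.differentiable_sigmaProd
  have h : L.sigmaFun = fun z ↦ z * L.sigmaProd z := funext L.sigmaFun_eq
  rw [h]
  fun_prop

lemma div_coe_ne_one {z : ℂ} (hz : z ∉ L.lattice) (l : L.lattice) : z / l ≠ 1 := by
  intro h
  have hl : (l : ℂ) ≠ 0 := by
    intro h0
    simp [h0] at h
  rw [div_eq_one_iff_eq hl] at h
  exact hz (h ▸ l.2)

lemma sigmaProd_ne_zero_of_forall {z : ℂ} (hz : ∀ l : L.lattice, z / l ≠ 1) :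
    L.sigmaProd z ≠ 0 := by
  have := tprod_one_add_ne_zero_of_summable (R := ℂ)
    (f := fun l : L.lattice ↦ primaryFactor (z / l) - 1)
    (fun l ↦ by simpa [primaryFactor_eq_zero_iff] using hz l) ?_
  · simpa [sigmaProd] using this
  · refine ((L.summable_sigma_bound (‖z‖ + 1))).of_norm_bounded_eventually ?_
    filter_upwards [L.primaryFactor_bound (r := ‖z‖ + 1) (by positivity)] with l hl
    simpa using hl z (by simp)

lemma sigmaProd_ne_zero {z : ℂ} (hz : z ∉ L.lattice) : L.sigmaProd z ≠ 0 :=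
  L.sigmaProd_ne_zero_of_forall (L.div_coe_ne_one hz)

@[simp] lemma sigmaProd_zero : L.sigmaProd 0 = 1 := by
  simp [sigmaProd, primaryFactor]

lemma sigmaProd_neg (z : ℂ) : L.sigmaProd (-z) = L.sigmaProd z := by
  rw [sigmaProd, ← (Equiv.neg L.lattice).tprod_eq]
  simp [sigmaProd, neg_div_neg_eq]

lemma sigmaFun_neg (z : ℂ) : L.sigmaFun (-z) = -L.sigmaFun z := by
  rw [sigmaFun_eq, sigmaFun_eq, sigmaProd_neg, neg_mul]

lemma sigmaFun_eq_zero_iff {z : ℂ} : L.sigmaFun z = 0 ↔ z ∈ L.lattice := by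
  constructor
  · intro h
    by_contra hz
    rw [sigmaFun_eq, mul_eq_zero] at h
    rcases h with rfl | h
    · exact hz (zero_mem _)
    · exact L.sigmaProd_ne_zero hz h
  · intro hz
    rw [sigmaFun_eq, mul_eq_zero, or_iff_not_imp_left]
    intro h0
    exact tprod_of_exists_eq_zero ⟨⟨z, hz⟩, by simp [primaryFactor_eq_zero_iff, div_self h0]⟩

@[simp] lemma sigmaFun_zero : L.sigmaFun 0 = 0 := L.sigmaFun_eq_zero_iff.mpr (zero_mem _)

lemma zetaFun_bound {r : ℝ} (hr : 0 < r) {z l : ℂ} (hz : ‖z‖ < r) (hl : 2 * r ≤ ‖l‖) :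
    ‖1 / (z - l) + 1 / l + z / l ^ 2‖ ≤ 2 * r ^ 2 * ‖l‖ ^ (-3 : ℝ) := by
  have hl0 : 0 < ‖l‖ := by linarith
  have h1 : l ≠ 0 := norm_pos_iff.mp hl0
  have h3 : ‖l‖ / 2 ≤ ‖z - l‖ := by
    rw [norm_sub_rev]
    exact .trans (by linarith) (norm_sub_norm_le l z)
  have h2 : z - l ≠ 0 := norm_pos_iff.mp (by linarith)
  -- The sum collapses to a single fraction of order |l|⁻³.
  have : 1 / (z - l) + 1 / l + z / l ^ 2 = z ^ 2 / (l ^ 2 * (z - l)) := by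
    field_simp
    ring
  rw [this, Real.rpow_neg hl0.le]
  norm_cast
  rw [norm_div, norm_mul, norm_pow, norm_pow]
  calc ‖z‖ ^ 2 / (‖l‖ ^ 2 * ‖z - l‖) ≤ r ^ 2 / (‖l‖ ^ 2 * (‖l‖ / 2)) := by gcongr
    _ = _ := by field_simp

lemma hasSumLocallyUniformly_zetaFun :
    HasSumLocallyUniformly (fun (l : L.lattice) (z : ℂ) ↦
      1 / (z - (l : ℂ)) + 1 / (l : ℂ) + z / (l : ℂ) ^ 2) L.zetaFun := by
  refine L.hasSumLocallyUniformly_aux _ (fun r l ↦ 2 * r ^ 2 * ‖(l : ℂ)‖ ^ (-3 : ℝ))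
    (fun r _ ↦ (ZLattice.summable_norm_rpow _ _ (by simp; norm_num)).mul_left _) fun r hr ↦ ?_
  filter_upwards [eventually_ge_atTop (2 * r)]
  rintro _ h s hs l rfl
  exact zetaFun_bound hr hs h

lemma hasSum_zetaFun (z : ℂ) :
    HasSum (fun l : L.lattice ↦ 1 / (z - (l : ℂ)) + 1 / (l : ℂ) + z / (l : ℂ) ^ 2)
      (L.zetaFun z) :=
  L.hasSumLocallyUniformly_zetaFun.hasSum

lemma hasDerivAt_zetaSummand {z l : ℂ} (h : z ≠ l) :
    HasDerivAt (fun z ↦ 1 / (z - l) + 1 / l + z / l ^ 2) (-(1 / (z - l) ^ 2 - 1 / l ^ 2)) z := by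
  have h1 : z - l ≠ 0 := sub_ne_zero.mpr h
  have h2 : HasDerivAt (fun z ↦ z - l) 1 z := (hasDerivAt_id z).sub_const l
  have h3 : HasDerivAt (fun z ↦ 1 / (z - l)) (-1 / (z - l) ^ 2) z := by
    simpa only [one_div] using! h2.inv h1
  convert! (h3.add_const (1 / l)).add ((hasDerivAt_id z).div_const (l ^ 2)) using 1
  ring

lemma ne_coe_of_notMem {z : ℂ} (hz : z ∉ L.lattice) (l : L.lattice) : z ≠ l :=
  fun h ↦ hz (h ▸ l.2)

lemma differentiableOn_zetaFun : DifferentiableOn ℂ L.zetaFun (L.lattice : Set ℂ)ᶜ := by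
  refine L.hasSumLocallyUniformly_zetaFun.tendstoLocallyUniformlyOn.differentiableOn
    (.of_forall fun s ↦ .fun_sum fun l hl z hz ↦ ?_) L.isClosed_lattice.isOpen_compl
  exact (hasDerivAt_zetaSummand
    (L.ne_coe_of_notMem hz l)).differentiableAt.differentiableWithinAt

lemma hasDerivAt_zetaFun {z : ℂ} (hz : z ∉ L.lattice) :
    HasDerivAt L.zetaFun (-L.weierstrassP z) z := by
  have hopen : IsOpen (L.lattice : Set ℂ)ᶜ := L.isClosed_lattice.isOpen_compl
  have hd := (L.differentiableOn_zetaFun.differentiableAt (hopen.mem_nhds hz)).hasDerivAt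
  convert! hd using 1
  have h1 := (L.hasSumLocallyUniformly_zetaFun.tendstoLocallyUniformlyOn
    (s := (L.lattice : Set ℂ)ᶜ)).deriv (.of_forall fun s ↦ .fun_sum fun l hl z hz ↦
      (hasDerivAt_zetaSummand (L.ne_coe_of_notMem hz l)).differentiableAt.differentiableWithinAt)
      hopen
  have h2 : HasSum (fun l : L.lattice ↦ -(1 / (z - (l : ℂ)) ^ 2 - 1 / (l : ℂ) ^ 2))
      (-L.weierstrassP z) := (L.hasSum_weierstrassP z).neg
  refine tendsto_nhds_unique h2 ((h1.tendsto_at hz).congr fun s ↦ ?_)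
  simp only [Function.comp_apply]
  rw [deriv_fun_sum fun l _ ↦ (hasDerivAt_zetaSummand (L.ne_coe_of_notMem hz l)).differentiableAt]
  exact Finset.sum_congr rfl fun l _ ↦ (hasDerivAt_zetaSummand (L.ne_coe_of_notMem hz l)).deriv

lemma logDeriv_primaryFactor_div {z : ℂ} (hz : z ∉ L.lattice) (l : L.lattice) :
    logDeriv (fun z ↦ primaryFactor (z / l)) z =
      if l = 0 then 0 else 1 / (z - (l : ℂ)) + 1 / (l : ℂ) + z / (l : ℂ) ^ 2 := by
  split_ifs with h
  · simp [h, logDeriv_apply]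
  have hl : (l : ℂ) ≠ 0 := by simpa using h
  have h1 := L.div_coe_ne_one hz l
  have h3 : z - l ≠ 0 := sub_ne_zero.mpr (L.ne_coe_of_notMem hz l)
  have := logDeriv_comp (f := primaryFactor) (g := fun z : ℂ ↦ z / (l : ℂ)) (x := z)
    (differentiable_primaryFactor _) (by fun_prop)
  rw [Function.comp_def] at this
  rw [this, logDeriv_primaryFactor h1, deriv_div_const, deriv_id'']
  have h4 : z / (l : ℂ) - 1 ≠ 0 := sub_ne_zero.mpr h1
  have h5 : z / (l : ℂ) - 1 = (z - l) / l := by field_simp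
  rw [h5]
  field_simp

lemma logDeriv_sigmaFun {z : ℂ} (hz : z ∉ L.lattice) :
    logDeriv L.sigmaFun z = L.zetaFun z := by
  have hz0 : z ≠ 0 := fun h ↦ hz (h ▸ zero_mem _)
  have hr : 0 < ‖z‖ + 1 := by positivity
  have hs := L.hasSum_zetaFun z
  -- At l = 0 the factor of the product is the constant 1, while the zeta series has the term 1/z
  -- there; resetting that term to 0 accounts for the difference.
  have hs' : HasSum (fun l : L.lattice ↦ logDeriv (fun z ↦ primaryFactor (z / l)) z)
      (L.zetaFun z - 1 / z) := by
    simp_rw [L.logDeriv_primaryFactor_div hz]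
    convert! hs.update 0 0 using 1
    · ext l
      simp [Function.update_apply]
    · simp
      ring
  have h1 : logDeriv L.sigmaProd z = L.zetaFun z - 1 / z := by
    rw [← hs'.tsum_eq]
    refine logDeriv_tprod_eq_tsum (s := Metric.ball 0 (‖z‖ + 1)) Metric.isOpen_ball (by simp)
      (fun l ↦ ?_) (fun l ↦ ?_) hs'.summable ⟨_, L.hasProdLocallyUniformlyOn_sigmaProd hr⟩
      (L.sigmaProd_ne_zero hz)
    · simpa [primaryFactor_eq_zero_iff] using L.div_coe_ne_one hz l
    · have := differentiable_primaryFactor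
      fun_prop
  have h : L.sigmaFun = fun z ↦ z * L.sigmaProd z := funext L.sigmaFun_eq
  rw [h, logDeriv_mul z hz0 (L.sigmaProd_ne_zero hz) (by fun_prop) (L.differentiable_sigmaProd z),
    h1]
  simp

lemma zetaFun_neg (z : ℂ) : L.zetaFun (-z) = -L.zetaFun z := by
  rw [zetaFun, ← (Equiv.neg L.lattice).tsum_eq, zetaFun, ← tsum_neg]
  congr! 2 with l
  simp only [Equiv.neg_apply, NegMemClass.coe_neg, even_two, Even.neg_pow]
  rw [show -z - -(l : ℂ) = -(z - l) by ring, div_neg, div_neg]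
  ring

/-- A countable set does not disconnect a real plane. Off the lattice, zero derivative therefore
means one global constant. -/
lemma isPreconnected_compl_lattice : IsPreconnected (L.lattice : Set ℂ)ᶜ := by
  have : Countable L.lattice := L.latticeEquivProd.toEquiv.countable_iff.mpr inferInstance
  exact ((Set.countable_coe_iff.mp this).isPathConnected_compl_of_one_lt_rank (by
    rw [Complex.rank_real_complex]; norm_num)).isConnected.isPreconnected

lemma add_mem_lattice_iff {z l : ℂ} (hl : l ∈ L.lattice) : z + l ∈ L.lattice ↔ z ∈ L.lattice :=
  L.lattice.toAddSubgroup.add_mem_cancel_right hl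

/-- Since ζ' = −℘ is periodic, ζ(z + l) − ζ(z) has zero derivative. -/
lemma exists_zetaFun_add {l : ℂ} (hl : l ∈ L.lattice) :
    ∃ η : ℂ, ∀ z ∉ L.lattice, L.zetaFun (z + l) = L.zetaFun z + η := by
  have hopen : IsOpen (L.lattice : Set ℂ)ᶜ := L.isClosed_lattice.isOpen_compl
  have hd : ∀ z ∉ L.lattice, HasDerivAt (fun z ↦ L.zetaFun (z + l) - L.zetaFun z) 0 z := by
    intro z hz
    have hz' : z + l ∉ L.lattice := (L.add_mem_lattice_iff hl).not.mpr hz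
    have := ((L.hasDerivAt_zetaFun hz').comp_add_const z l).sub (L.hasDerivAt_zetaFun hz)
    rw [L.weierstrassP_add_coe z ⟨l, hl⟩, sub_self] at this
    exact this
  obtain ⟨η, hη⟩ := hopen.exists_is_const_of_deriv_eq_zero L.isPreconnected_compl_lattice
    (fun z hz ↦ (hd z hz).differentiableAt.differentiableWithinAt) (fun z hz ↦ (hd z hz).deriv)
  exact ⟨η, fun z hz ↦ by linear_combination hη z hz⟩

/-- The quasi-periodicity of the sigma function. -/
lemma exists_sigmaFun_add {l : ℂ} (hl : l ∈ L.lattice) :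
    ∃ c η : ℂ, (∀ z ∉ L.lattice, L.zetaFun (z + l) = L.zetaFun z + η) ∧ c ≠ 0 ∧
      ∀ z, L.sigmaFun (z + l) = c * Complex.exp (η * z) * L.sigmaFun z := by
  obtain ⟨η, hη⟩ := L.exists_zetaFun_add hl
  have hopen : IsOpen (L.lattice : Set ℂ)ᶜ := L.isClosed_lattice.isOpen_compl
  have hne {z : ℂ} (hz : z ∉ L.lattice) : L.sigmaFun z ≠ 0 := L.sigmaFun_eq_zero_iff.not.mpr hz
  have hσ {z : ℂ} (hz : z ∉ L.lattice) :
      HasDerivAt L.sigmaFun (L.zetaFun z * L.sigmaFun z) z := by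
    rw [← L.logDeriv_sigmaFun hz, logDeriv_apply, div_mul_cancel₀ _ (hne hz)]
    exact (L.differentiable_sigmaFun z).hasDerivAt
  -- The logarithmic derivative of the quotient is ζ(z + l) − ζ(z) − η = 0.
  have hd : ∀ z ∉ L.lattice,
      HasDerivAt (fun z ↦ L.sigmaFun (z + l) / (Complex.exp (η * z) * L.sigmaFun z)) 0 z := by
    intro z hz
    have hz' : z + l ∉ L.lattice := (L.add_mem_lattice_iff hl).not.mpr hz
    have he : HasDerivAt (fun z ↦ Complex.exp (η * z)) (Complex.exp (η * z) * η) z := by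
      have := ((hasDerivAt_id z).const_mul η).cexp
      simpa using this
    have := ((hσ hz').comp_add_const z l).div (he.mul (hσ hz))
      (mul_ne_zero (Complex.exp_ne_zero _) (hne hz))
    convert! this using 1
    simp only [Pi.mul_apply]
    rw [hη z hz]
    field_simp
    ring
  obtain ⟨c, hc⟩ := hopen.exists_is_const_of_deriv_eq_zero L.isPreconnected_compl_lattice
    (fun z hz ↦ (hd z hz).differentiableAt.differentiableWithinAt) (fun z hz ↦ (hd z hz).deriv)
  have hc' : ∀ z, L.sigmaFun (z + l) = c * Complex.exp (η * z) * L.sigmaFun z := by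
    intro z
    by_cases hz : z ∈ L.lattice
    · rw [L.sigmaFun_eq_zero_iff.mpr hz, mul_zero, L.sigmaFun_eq_zero_iff]
      exact add_mem hz hl
    · have := hc z hz
      rw [div_eq_iff (mul_ne_zero (Complex.exp_ne_zero _) (hne hz))] at this
      rw [this, mul_assoc]
  refine ⟨c, η, hη, ?_, hc'⟩
  rintro rfl
  -- If c = 0, then σ would vanish at ω₁/2 + l, which is not a lattice point.
  have hz := L.ω₁_div_two_notMem_lattice
  have := hc' (L.ω₁ / 2)
  rw [zero_mul, zero_mul, L.sigmaFun_eq_zero_iff, L.add_mem_lattice_iff hl] at this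
  exact hz this

end PeriodPair

/-! ### Elliptic functions: Liouville, surjectivity of ℘, sigma factorization. -/

namespace PeriodPair

variable (L : PeriodPair)

/-- An elliptic function whose only possible pole modulo the lattice is at `0`, where it is
`o(1 / z)`, is constant. -/
lemma exists_eq_const_of_periodic {f : ℂ → ℂ} (hd : ∀ z ∉ L.lattice, DifferentiableAt ℂ f z)
    (hp : ∀ z ∉ L.lattice, ∀ l ∈ L.lattice, f (z + l) = f z)
    (h0 : Tendsto (fun z ↦ z * f z) (𝓝[≠] 0) (𝓝 0)) : ∃ c, ∀ z ∉ L.lattice, f z = c := by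
  classical
  set U : Set ℂ := ((L.lattice : Set ℂ) \ {0})ᶜ with hU
  have hU0 : U ∈ 𝓝 0 := L.compl_lattice_sdiff_singleton_mem_nhds 0
  have hUc {z : ℂ} (hz : z ∈ U) (hz0 : z ≠ 0) : z ∉ L.lattice := fun h ↦ hz ⟨h, hz0⟩
  set c := limUnder (𝓝[≠] (0 : ℂ)) f with hc
  have hup : DifferentiableOn ℂ (Function.update f 0 c) U := by
    refine Complex.differentiableOn_update_limUnder_of_isLittleO hU0 (fun z hz ↦
      (hd z (hUc hz.1 hz.2)).differentiableWithinAt) ?_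
    rw [Asymptotics.isLittleO_iff_tendsto' (by
      filter_upwards [self_mem_nhdsWithin] with z hz h
      simp at h
      exact absurd h hz)]
    have h1 : Tendsto (fun z : ℂ ↦ z * f 0) (𝓝[≠] 0) (𝓝 0) := by
      have : Continuous fun z : ℂ ↦ z * f 0 := by fun_prop
      simpa using (this.tendsto 0).mono_left nhdsWithin_le_nhds
    have := h0.sub h1
    rw [sub_zero] at this
    refine this.congr fun z ↦ ?_
    simp
    ring
  -- Filling every lattice point with the removable value c at 0 gives an entire periodic function,
  -- which is bounded, hence constant.
  set g : ℂ → ℂ := fun z ↦ if z ∈ L.lattice then c else f z with hg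
  have hgp : ∀ z, ∀ l ∈ L.lattice, g (z + l) = g z := by
    intro z l hl
    simp only [hg, L.add_mem_lattice_iff hl]
    split_ifs with h
    · rfl
    · exact hp z h l hl
  have hg0 : DifferentiableAt ℂ g 0 := by
    refine (hup.differentiableAt hU0).congr_of_eventuallyEq ?_
    filter_upwards [hU0] with z hz
    by_cases h : z = 0
    · simp [h, hg, zero_mem]
    · simp [hg, hUc hz h, h]
  have hgd : Differentiable ℂ g := by
    intro z
    by_cases hz : z ∈ L.lattice
    · have h1 : g = fun w ↦ g (w + -z) := funext fun w ↦ (hgp w (-z) (neg_mem hz)).symm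
      rw [h1]
      refine DifferentiableAt.comp (g := g) z ?_ (by fun_prop)
      simpa using hg0
    · refine (hd z hz).congr_of_eventuallyEq ?_
      filter_upwards [L.isClosed_lattice.isOpen_compl.mem_nhds hz] with w hw
      exact if_neg hw
  refine ⟨g 0, fun z hz ↦ ?_⟩
  rw [← hgd.apply_eq_apply_of_bounded (IsZLattice.isCompact_range_of_periodic L.lattice g
    hgd.continuous hgp).isBounded z 0]
  exact (if_neg hz).symm

lemma hasDerivAt_weierstrassP {z : ℂ} (hz : z ∉ L.lattice) :
    HasDerivAt L.weierstrassP (L.derivWeierstrassP z) z := by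
  rw [← deriv_weierstrassP]
  exact (L.differentiableOn_weierstrassP.differentiableAt
    (L.isClosed_lattice.isOpen_compl.mem_nhds hz)).hasDerivAt

lemma sq_mul_weierstrassP {z : ℂ} (hz : z ≠ 0) :
    z ^ 2 * L.weierstrassP z = z ^ 2 * L.weierstrassPExcept 0 z + 1 := by
  have := L.ite_eq_one_sub_sq_mul_weierstrassP 0 (zero_mem _) z
  simpa [hz] using this

lemma differentiableAt_weierstrassPExcept_zero : DifferentiableAt ℂ (L.weierstrassPExcept 0) 0 :=
  (L.analyticAt_weierstrassPExcept 0).differentiableAt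

lemma tendsto_sq_mul_weierstrassP_sub (c : ℂ) :
    Tendsto (fun z ↦ z ^ 2 * (L.weierstrassP z - c)) (𝓝[≠] 0) (𝓝 1) := by
  have h1 : ContinuousAt (fun z ↦ z ^ 2 * L.weierstrassPExcept 0 z + 1 - z ^ 2 * c) 0 := by
    have := L.differentiableAt_weierstrassPExcept_zero.continuousAt
    fun_prop
  have h2 := h1.tendsto.mono_left (nhdsWithin_le_nhds (s := {0}ᶜ))
  simp only [ne_eq, OfNat.ofNat_ne_zero, not_false_eq_true, zero_pow, zero_mul, zero_add,
    sub_zero] at h2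
  refine h2.congr' ?_
  filter_upwards [self_mem_nhdsWithin] with z hz
  rw [mul_sub, L.sq_mul_weierstrassP hz]

/-- If ℘ omitted c, then 1/(℘ − c) would be elliptic without poles, hence constant. It tends to 0 at
the origin, so it would be identically 0, which an inverse cannot be. -/
lemma exists_weierstrassP_eq (c : ℂ) : ∃ z ∉ L.lattice, L.weierstrassP z = c := by
  by_contra! hne
  have hne' : ∀ z ∉ L.lattice, L.weierstrassP z - c ≠ 0 := fun z hz ↦ sub_ne_zero.mpr (hne z hz)
  have ht : Tendsto (fun z ↦ (L.weierstrassP z - c)⁻¹) (𝓝[≠] 0) (𝓝 0) := by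
    have h1 := (L.tendsto_sq_mul_weierstrassP_sub c).inv₀ one_ne_zero
    have h2 : Tendsto (fun z : ℂ ↦ z ^ 2) (𝓝[≠] 0) (𝓝 0) := by
      have : Continuous fun z : ℂ ↦ z ^ 2 := by fun_prop
      simpa using (this.tendsto 0).mono_left nhdsWithin_le_nhds
    have h3 := h2.mul h1
    rw [zero_mul] at h3
    refine h3.congr' ?_
    filter_upwards [self_mem_nhdsWithin] with z (hz : z ≠ 0)
    field_simp
  obtain ⟨d, hd⟩ := L.exists_eq_const_of_periodic (f := fun z ↦ (L.weierstrassP z - c)⁻¹)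
    (fun z hz ↦ (((L.hasDerivAt_weierstrassP hz).sub_const c).inv (hne' z hz)).differentiableAt)
    (fun z _ l hl ↦ by rw [L.weierstrassP_add_coe z ⟨l, hl⟩])
    (by
      have h1 : Tendsto (fun z : ℂ ↦ z) (𝓝[≠] 0) (𝓝 0) := tendsto_id.mono_left nhdsWithin_le_nhds
      simpa using h1.mul ht)
  have hev : ∀ᶠ z in 𝓝[≠] (0 : ℂ), (L.weierstrassP z - c)⁻¹ = d := by
    filter_upwards [self_mem_nhdsWithin, mem_nhdsWithin_of_mem_nhds
      (L.compl_lattice_sdiff_singleton_mem_nhds 0)] with z hz hz'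
    exact hd z fun h ↦ hz' ⟨h, hz⟩
  have hd0 : d = 0 := tendsto_nhds_unique (tendsto_const_nhds.congr' (hev.mono fun _ h ↦ h.symm)) ht
  exact inv_ne_zero (hne' _ L.ω₁_div_two_notMem_lattice) ((hd _ L.ω₁_div_two_notMem_lattice).trans hd0)

/-- The factorization of `℘ z - ℘ a` into sigma functions. -/
lemma sigmaFun_sub_mul_sigmaFun_add {z a : ℂ} (hz : z ∉ L.lattice) (ha : a ∉ L.lattice) :
    L.sigmaFun (z - a) * L.sigmaFun (z + a) =
      -(L.sigmaFun z ^ 2 * L.sigmaFun a ^ 2 * (L.weierstrassP z - L.weierstrassP a)) := by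
  have hne {z : ℂ} (hz : z ∉ L.lattice) : L.sigmaFun z ≠ 0 := L.sigmaFun_eq_zero_iff.not.mpr hz
  have hσ := L.differentiable_sigmaFun
  -- The difference of the two sides, divided by σ(z)², is elliptic and vanishes at z = a; it
  -- remains to see that it has no pole at 0.
  set f : ℂ → ℂ := fun z ↦ L.sigmaFun (z - a) * L.sigmaFun (z + a) / L.sigmaFun z ^ 2 +
    L.sigmaFun a ^ 2 * (L.weierstrassP z - L.weierstrassP a) with hf
  have hd : ∀ z ∉ L.lattice, DifferentiableAt ℂ f z := by
    intro z hz
    have h1 := (L.hasDerivAt_weierstrassP hz).differentiableAt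
    have h2 : L.sigmaFun z ^ 2 ≠ 0 := pow_ne_zero _ (hne hz)
    simp only [hf]
    fun_prop (disch := assumption)
  have hp : ∀ z ∉ L.lattice, ∀ l ∈ L.lattice, f (z + l) = f z := by
    intro z hz l hl
    obtain ⟨c, η, -, hc, h⟩ := L.exists_sigmaFun_add hl
    have h1 : Complex.exp (η * (z - a)) * Complex.exp (η * (z + a)) =
        Complex.exp (η * z) ^ 2 := by
      rw [← Complex.exp_add, ← Complex.exp_nat_mul]
      congr 1
      push_cast
      ring
    simp only [hf]
    rw [show z + l - a = z - a + l by ring, show z + l + a = z + a + l by ring, h, h, h,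
      L.weierstrassP_add_coe z ⟨l, hl⟩]
    congr 1
    have := hne hz
    have := Complex.exp_ne_zero (η * z)
    field_simp
    linear_combination L.sigmaFun (z - a) * L.sigmaFun (z + a) * h1
  have h0 : Tendsto (fun z ↦ z * f z) (𝓝[≠] 0) (𝓝 0) := by
    -- N extends z² f(z) across 0. It is even with N(0) = 0, hence N'(0) = 0 and z f(z) = N(z)/z
    -- tends to 0.
    set N : ℂ → ℂ := fun z ↦ L.sigmaFun (z - a) * L.sigmaFun (z + a) / L.sigmaProd z ^ 2 +
      L.sigmaFun a ^ 2 * (z ^ 2 * L.weierstrassPExcept 0 z + 1 - z ^ 2 * L.weierstrassP a) with hN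
    have hNd : DifferentiableAt ℂ N 0 := by
      have h1 := L.differentiableAt_weierstrassPExcept_zero
      have h2 : L.sigmaProd 0 ^ 2 ≠ 0 := by simp
      have h3 := L.differentiable_sigmaProd
      simp only [hN]
      fun_prop (disch := assumption)
    have hNeven : ∀ z, N (-z) = N z := by
      intro z
      have h1 := L.weierstrassPExcept_neg 0 z
      rw [neg_zero] at h1
      simp only [hN]
      rw [h1, L.sigmaProd_neg, show -z - a = -(z + a) by ring, show -z + a = -(z - a) by ring,
        L.sigmaFun_neg, L.sigmaFun_neg]
      ring
    have hN0 : N 0 = 0 := by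
      simp [hN, L.sigmaFun_neg]
      ring
    have hN' : deriv N 0 = 0 := by
      have h1 : deriv (fun z ↦ N (-z)) 0 = deriv N 0 := by simp_rw [hNeven]
      rw [deriv_comp_neg, neg_zero] at h1
      exact CharZero.eq_neg_self_iff.mp h1.symm
    have h1 := hNd.hasDerivAt
    rw [hN', hasDerivAt_iff_tendsto_slope_zero] at h1
    refine h1.congr' ?_
    filter_upwards [self_mem_nhdsWithin] with z (hz : z ≠ 0)
    rw [zero_add, hN0, sub_zero, smul_eq_mul, hN, hf]
    simp only
    rw [← L.sq_mul_weierstrassP hz, L.sigmaFun_eq z]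
    field_simp
  obtain ⟨c, hc⟩ := L.exists_eq_const_of_periodic hd hp h0
  have h1 : f z = 0 := by
    rw [hc z hz, ← hc a ha]
    simp [hf]
  have := hne hz
  simp only [hf] at h1
  field_simp at h1
  linear_combination h1

lemma hasDerivAt_sigmaFun_zero : HasDerivAt L.sigmaFun 1 0 := by
  have h : L.sigmaFun = fun z ↦ z * L.sigmaProd z := funext L.sigmaFun_eq
  rw [h]
  simpa using! (hasDerivAt_id (0 : ℂ)).mul (L.differentiable_sigmaProd 0).hasDerivAt

/-- This is the derivative at z = v of the factorization of ℘(z) − ℘(v). -/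
lemma sigmaFun_two_mul {v : ℂ} (hv : v ∉ L.lattice) :
    L.sigmaFun (2 * v) = -(L.derivWeierstrassP v * L.sigmaFun v ^ 4) := by
  have hσ := L.differentiable_sigmaFun
  have h1 : HasDerivAt (fun z ↦ L.sigmaFun (z - v) * L.sigmaFun (z + v))
      (L.sigmaFun (2 * v)) v := by
    have h2 : HasDerivAt (fun z ↦ L.sigmaFun (z - v)) 1 v := by
      refine HasDerivAt.comp_sub_const v v ?_
      simpa using L.hasDerivAt_sigmaFun_zero
    have h3 := (hσ (v + v)).hasDerivAt.comp_add_const v v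
    convert! h2.mul h3 using 1
    simp [two_mul]
  have h4 : HasDerivAt (fun z ↦ -(L.sigmaFun z ^ 2 * L.sigmaFun v ^ 2 *
      (L.weierstrassP z - L.weierstrassP v))) (-(L.derivWeierstrassP v * L.sigmaFun v ^ 4)) v := by
    have h5 := (((hσ v).hasDerivAt.pow 2).mul_const (L.sigmaFun v ^ 2)).mul
      ((L.hasDerivAt_weierstrassP hv).sub_const (L.weierstrassP v))
    convert! h5.neg using 1
    simp
    ring
  refine h1.unique (h4.congr_of_eventuallyEq ?_)
  filter_upwards [L.isClosed_lattice.isOpen_compl.mem_nhds hv] with z hz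
  exact L.sigmaFun_sub_mul_sigmaFun_add hz hv

lemma derivWeierstrassP_eq_zero_iff {v : ℂ} (hv : v ∉ L.lattice) :
    L.derivWeierstrassP v = 0 ↔ 2 * v ∈ L.lattice := by
  rw [← L.sigmaFun_eq_zero_iff, L.sigmaFun_two_mul hv, neg_eq_zero, mul_eq_zero,
    or_iff_left (pow_ne_zero _ (L.sigmaFun_eq_zero_iff.not.mpr hv))]

lemma weierstrassP_eq_iff {u v : ℂ} (hu : u ∉ L.lattice) (hv : v ∉ L.lattice) :
    L.weierstrassP u = L.weierstrassP v ↔ u - v ∈ L.lattice ∨ u + v ∈ L.lattice := by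
  rw [← L.sigmaFun_eq_zero_iff, ← L.sigmaFun_eq_zero_iff, ← mul_eq_zero,
    L.sigmaFun_sub_mul_sigmaFun_add hu hv, neg_eq_zero, mul_eq_zero, sub_eq_zero, or_iff_right]
  exact mul_ne_zero (pow_ne_zero _ (L.sigmaFun_eq_zero_iff.not.mpr hu))
    (pow_ne_zero _ (L.sigmaFun_eq_zero_iff.not.mpr hv))

/-! ### The function Φ of a half-period: square, addition and duplication. -/

section HalfPeriod

variable {L} {ω : ℂ}

/-- Evaluating the quasi-periodicity laws for the period 2ω at −ω, where ζ and σ are odd, identifies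
both the quasi-period 2ζ(ω) and the multiplier. -/
lemma sigmaFun_add_halfPeriod (hω : ω ∉ L.lattice) (h2 : 2 * ω ∈ L.lattice) (z : ℂ) :
    L.sigmaFun (z + ω) = -(Complex.exp (2 * L.zetaFun ω * z) * L.sigmaFun (z - ω)) := by
  obtain ⟨c, η, hη, -, h⟩ := L.exists_sigmaFun_add h2
  have hne : L.sigmaFun ω ≠ 0 := L.sigmaFun_eq_zero_iff.not.mpr hω
  have h1 : η = 2 * L.zetaFun ω := by
    have := hη (-ω) (by simpa using hω)
    rw [L.zetaFun_neg, show -ω + 2 * ω = ω by ring] at this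
    linear_combination -this
  have h3 : c * Complex.exp (η * -ω) = -1 := by
    have := h (-ω)
    rw [L.sigmaFun_neg, show -ω + 2 * ω = ω by ring] at this
    refine mul_right_cancel₀ hne ?_
    linear_combination this
  have h4 := h (z - ω)
  rw [show z - ω + 2 * ω = z + ω by ring, sub_eq_add_neg, mul_add, Complex.exp_add, ← sub_eq_add_neg]
    at h4
  rw [h4, ← h1]
  linear_combination Complex.exp (η * z) * L.sigmaFun (z - ω) * h3

lemma PhiFun_neg (hω : ω ∉ L.lattice) (h2 : 2 * ω ∈ L.lattice) (z : ℂ) :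
    L.PhiFun ω (-z) = -L.PhiFun ω z := by
  rw [PhiFun, PhiFun, sigmaFun_add_halfPeriod hω h2 z, L.sigmaFun_neg z,
    show -z + ω = -(z - ω) by ring, L.sigmaFun_neg,
    show -L.zetaFun ω * -z = 2 * L.zetaFun ω * z + -L.zetaFun ω * z by ring, Complex.exp_add]
  ring

/-- As Φ is odd, Φ(z)² = −Φ(z)Φ(−z). The exponentials cancel in this product and the sigma
factorization applies. -/
lemma PhiFun_sq (hω : ω ∉ L.lattice) (h2 : 2 * ω ∈ L.lattice) {z : ℂ} (hz : z ∉ L.lattice) :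
    L.PhiFun ω z ^ 2 = L.weierstrassP z - L.weierstrassP ω := by
  have h1 : L.PhiFun ω z ^ 2 = -(L.PhiFun ω z * L.PhiFun ω (-z)) := by
    rw [PhiFun_neg hω h2]
    ring
  have h3 := L.sigmaFun_sub_mul_sigmaFun_add hz hω
  have hne : L.sigmaFun ω ≠ 0 := L.sigmaFun_eq_zero_iff.not.mpr hω
  have hne' : L.sigmaFun z ≠ 0 := L.sigmaFun_eq_zero_iff.not.mpr hz
  have h4 : Complex.exp (-L.zetaFun ω * z) * Complex.exp (-L.zetaFun ω * -z) = 1 := by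
    rw [← Complex.exp_add]
    simp
  rw [h1, PhiFun, PhiFun, show -z + ω = -(z - ω) by ring, L.sigmaFun_neg, L.sigmaFun_neg]
  generalize Complex.exp (-L.zetaFun ω * z) = E₁ at *
  generalize Complex.exp (-L.zetaFun ω * -z) = E₂ at *
  field_simp
  linear_combination -(L.sigmaFun (z - ω) * L.sigmaFun (z + ω)) * h4 - h3

lemma PhiFun_mul_sigmaFun {z : ℂ} (hz : z ∉ L.lattice) :
    L.PhiFun ω z * L.sigmaFun z =
      L.sigmaFun (z + ω) * Complex.exp (-L.zetaFun ω * z) / L.sigmaFun ω := by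
  have hne' : L.sigmaFun z ≠ 0 := L.sigmaFun_eq_zero_iff.not.mpr hz
  rw [PhiFun]
  field_simp

lemma PhiFun_mul_PhiFun_add (hω : ω ∉ L.lattice) (h2 : 2 * ω ∈ L.lattice) {u : ℂ}
    (hu : u ∉ L.lattice) (hu' : u + ω ∉ L.lattice) :
    L.PhiFun ω u * L.PhiFun ω (u + ω) =
      -(Complex.exp (L.zetaFun ω * ω) / L.sigmaFun ω ^ 2) := by
  have hne : L.sigmaFun ω ≠ 0 := L.sigmaFun_eq_zero_iff.not.mpr hω
  have hne1 : L.sigmaFun u ≠ 0 := L.sigmaFun_eq_zero_iff.not.mpr hu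
  have hne2 : L.sigmaFun (u + ω) ≠ 0 := L.sigmaFun_eq_zero_iff.not.mpr hu'
  rw [PhiFun, PhiFun, sigmaFun_add_halfPeriod hω h2 (u + ω), add_sub_cancel_right]
  have h4 : Complex.exp (-L.zetaFun ω * u) * Complex.exp (2 * L.zetaFun ω * (u + ω)) *
      Complex.exp (-L.zetaFun ω * (u + ω)) = Complex.exp (L.zetaFun ω * ω) := by
    rw [← Complex.exp_add, ← Complex.exp_add]
    ring_nf
  rw [← h4]
  field_simp

/-- The translation of `℘` by a half-period. -/
lemma weierstrassP_sub_mul_weierstrassP_add_sub (hω : ω ∉ L.lattice) (h2 : 2 * ω ∈ L.lattice)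
    {u : ℂ} (hu : u ∉ L.lattice) (hu' : u + ω ∉ L.lattice) :
    (L.weierstrassP u - L.weierstrassP ω) * (L.weierstrassP (u + ω) - L.weierstrassP ω) =
      3 * L.weierstrassP ω ^ 2 - L.g₂ / 4 := by
  set e := L.weierstrassP ω with he
  set C : ℂ := (-(Complex.exp (L.zetaFun ω * ω) / L.sigmaFun ω ^ 2)) ^ 2 with hC
  have hne : L.sigmaFun ω ≠ 0 := L.sigmaFun_eq_zero_iff.not.mpr hω
  have hC0 : C ≠ 0 := by
    have := Complex.exp_ne_zero (L.zetaFun ω * ω)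
    rw [hC]
    exact pow_ne_zero _ (neg_ne_zero.mpr (div_ne_zero this (pow_ne_zero _ hne)))
  have key : ∀ u ∉ L.lattice, u + ω ∉ L.lattice →
      (L.weierstrassP u - e) * (L.weierstrassP (u + ω) - e) = C := by
    intro u hu hu'
    rw [← PhiFun_sq hω h2 hu, ← PhiFun_sq hω h2 hu', ← mul_pow, PhiFun_mul_PhiFun_add hω h2 hu hu']
  rw [key u hu hu']
  -- The product is already known to be a constant C; one well-chosen point determines it. Requiring
  -- t² ≠ C excludes t = y below, where t y = C.
  obtain ⟨t, ht0, htC⟩ : ∃ t : ℂ, t ≠ 0 ∧ t ^ 2 ≠ C := by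
    by_cases h : C = 1
    · exact ⟨2, two_ne_zero, by rw [h]; norm_num⟩
    · exact ⟨1, one_ne_zero, by rw [one_pow]; exact fun h' ↦ h h'.symm⟩
  clear hu hu' u
  obtain ⟨u, hu, hut⟩ := L.exists_weierstrassP_eq (e + t)
  have hu' : u + ω ∉ L.lattice := by
    intro h
    have := L.weierstrassP_sub_coe u ⟨_, h⟩
    rw [show u - (⟨u + ω, h⟩ : L.lattice) = -ω by simp, L.weierstrassP_neg, hut] at this
    exact ht0 (by linear_combination -this)
  have hx := key u hu hu'
  have hopen : IsOpen (L.lattice : Set ℂ)ᶜ := L.isClosed_lattice.isOpen_compl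
  have hderiv : L.derivWeierstrassP u * (L.weierstrassP (u + ω) - e) +
      (L.weierstrassP u - e) * L.derivWeierstrassP (u + ω) = 0 := by
    have h1 := ((L.hasDerivAt_weierstrassP hu).sub_const e).mul
      (((L.hasDerivAt_weierstrassP hu').comp_add_const u ω).sub_const e)
    refine h1.unique ((hasDerivAt_const u C).congr_of_eventuallyEq ?_)
    have hcont : ContinuousAt (fun z : ℂ ↦ z + ω) u := by fun_prop
    filter_upwards [hopen.mem_nhds hu, hcont.preimage_mem_nhds (hopen.mem_nhds hu')] with z hz hz'
    exact key z hz hz'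
  have h3 := L.derivWeierstrassP_sq u hu
  have h4 := L.derivWeierstrassP_sq (u + ω) hu'
  have h5 := L.derivWeierstrassP_sq ω hω
  rw [(L.derivWeierstrassP_eq_zero_iff hω).mpr h2, ← he] at h5
  set y := L.weierstrassP (u + ω) - e with hy
  rw [hut, add_sub_cancel_left] at hx hderiv
  have hyP : L.weierstrassP (u + ω) = e + y := by rw [hy]; ring
  rw [hut] at h3
  rw [hyP] at h4
  have hy0 : y ≠ 0 := by
    rintro h
    rw [h, mul_zero] at hx
    exact hC0 hx.symm
  have hty : t - y ≠ 0 := by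
    intro h
    apply htC
    rw [← hx]
    linear_combination t * h
  -- Squaring the differentiated relation and substituting the Weierstrass equation at u, u + ω and
  -- ω gives a factored polynomial identity, in which only the last factor can vanish.
  have h6 : t * y * ((t - y) * (t * y - (3 * e ^ 2 - L.g₂ / 4))) = 0 := by
    have h7 : (L.derivWeierstrassP u * y) ^ 2 = (t * L.derivWeierstrassP (u + ω)) ^ 2 := by
      linear_combination (L.derivWeierstrassP u * y - t * L.derivWeierstrassP (u + ω)) * hderiv
    rw [mul_pow, mul_pow, h3, h4] at h7
    linear_combination h7 / 4 - (t ^ 2 - y ^ 2) / 4 * h5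
  rcases mul_eq_zero.mp h6 with h | h
  · exact absurd h (mul_ne_zero ht0 hy0)
  · rcases mul_eq_zero.mp h with h | h
    · exact absurd h hty
    · rw [← hx]
      linear_combination h

/-- This is the sigma factorization at u + ω and v, rewritten by the translation of ℘ by ω. It does
not divide by σ(u ± v), so v = u is allowed and yields the duplication formula. -/
lemma sigmaFun_add_mul_sigmaFun_sub_halfPeriod (hω : ω ∉ L.lattice) (h2 : 2 * ω ∈ L.lattice)
    {u v : ℂ} (hu : u ∉ L.lattice) (hu' : u + ω ∉ L.lattice) (hv : v ∉ L.lattice) :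
    L.sigmaFun (u + v + ω) * Complex.exp (-L.zetaFun ω * (u + v)) / L.sigmaFun ω *
      (L.sigmaFun (u - v + ω) * Complex.exp (-L.zetaFun ω * (u - v)) / L.sigmaFun ω) =
    L.sigmaFun u ^ 2 * L.sigmaFun v ^ 2 *
      ((L.weierstrassP u - L.weierstrassP ω) * (L.weierstrassP v - L.weierstrassP ω) -
        (3 * L.weierstrassP ω ^ 2 - L.g₂ / 4)) := by
  have hne : L.sigmaFun ω ≠ 0 := L.sigmaFun_eq_zero_iff.not.mpr hω
  have h1 := L.sigmaFun_sub_mul_sigmaFun_add hu' hv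
  have h3 := PhiFun_mul_sigmaFun (ω := ω) hu
  rw [eq_div_iff hne] at h3
  rw [← weierstrassP_sub_mul_weierstrassP_add_sub hω h2 hu hu', ← PhiFun_sq hω h2 hu,
    show u + v + ω = u + ω + v by ring, show u - v + ω = u + ω - v by ring]
  have h4 : Complex.exp (-L.zetaFun ω * (u + v)) * Complex.exp (-L.zetaFun ω * (u - v)) =
      Complex.exp (-L.zetaFun ω * u) ^ 2 := by
    rw [← Complex.exp_add, ← Complex.exp_nat_mul]
    congr 1
    push_cast
    ring
  generalize Complex.exp (-L.zetaFun ω * (u + v)) = E₁ at *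
  generalize Complex.exp (-L.zetaFun ω * (u - v)) = E₂ at *
  generalize Complex.exp (-L.zetaFun ω * u) = E₃ at *
  field_simp
  linear_combination L.sigmaFun (u + ω - v) * L.sigmaFun (u + ω + v) * h4 +
    E₃ ^ 2 * h1 + (L.sigmaFun v ^ 2 *
      (L.weierstrassP (u + ω) - L.weierstrassP v) *
      (L.PhiFun ω u * L.sigmaFun u * L.sigmaFun ω +
        L.sigmaFun (u + ω) * E₃)) * h3

/-- The addition formula for `Φ`, in the product form. -/
lemma PhiFun_add_mul_PhiFun_sub (hω : ω ∉ L.lattice) (h2 : 2 * ω ∈ L.lattice)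
    {u v : ℂ} (hu : u ∉ L.lattice) (hu' : u + ω ∉ L.lattice) (hv : v ∉ L.lattice)
    (hadd : u + v ∉ L.lattice) (hsub : u - v ∉ L.lattice) :
    L.PhiFun ω (u + v) * L.PhiFun ω (u - v) * (L.weierstrassP v - L.weierstrassP u) =
      (L.weierstrassP u - L.weierstrassP ω) * (L.weierstrassP v - L.weierstrassP ω) -
        (3 * L.weierstrassP ω ^ 2 - L.g₂ / 4) := by
  have h1 := sigmaFun_add_mul_sigmaFun_sub_halfPeriod hω h2 hu hu' hv
  rw [← PhiFun_mul_sigmaFun hadd, ← PhiFun_mul_sigmaFun hsub] at h1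
  have h3 := L.sigmaFun_sub_mul_sigmaFun_add hu hv
  have hne : L.sigmaFun u ≠ 0 := L.sigmaFun_eq_zero_iff.not.mpr hu
  have hne' : L.sigmaFun v ≠ 0 := L.sigmaFun_eq_zero_iff.not.mpr hv
  refine mul_left_cancel₀ (mul_ne_zero (pow_ne_zero 2 hne) (pow_ne_zero 2 hne')) ?_
  linear_combination h1 - L.PhiFun ω (u + v) * L.PhiFun ω (u - v) * h3

/-- The duplication formula for `Φ`. -/
lemma PhiFun_two_mul (hω : ω ∉ L.lattice) (h2 : 2 * ω ∈ L.lattice)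
    {v : ℂ} (hv : v ∉ L.lattice) (hv' : v + ω ∉ L.lattice) (hv2 : 2 * v ∉ L.lattice) :
    L.PhiFun ω (2 * v) * L.derivWeierstrassP v =
      (3 * L.weierstrassP ω ^ 2 - L.g₂ / 4) - (L.weierstrassP v - L.weierstrassP ω) ^ 2 := by
  have hne : L.sigmaFun ω ≠ 0 := L.sigmaFun_eq_zero_iff.not.mpr hω
  have h1 := sigmaFun_add_mul_sigmaFun_sub_halfPeriod hω h2 hv hv' hv
  rw [← two_mul, ← PhiFun_mul_sigmaFun hv2, sub_self, zero_add, mul_zero, Complex.exp_zero,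
    mul_one, div_self hne, mul_one, L.sigmaFun_two_mul hv] at h1
  have hne' : L.sigmaFun v ≠ 0 := L.sigmaFun_eq_zero_iff.not.mpr hv
  refine mul_left_cancel₀ (pow_ne_zero 4 hne') ?_
  linear_combination -h1

lemma PhiFun_ne_zero (hω : ω ∉ L.lattice) {z : ℂ} (hz : z ∉ L.lattice) (hz' : z + ω ∉ L.lattice) :
    L.PhiFun ω z ≠ 0 :=
  div_ne_zero (mul_ne_zero (L.sigmaFun_eq_zero_iff.not.mpr hz') (Complex.exp_ne_zero _))
    (mul_ne_zero (L.sigmaFun_eq_zero_iff.not.mpr hω) (L.sigmaFun_eq_zero_iff.not.mpr hz))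

lemma tendsto_PhiFun_cobounded (hω : ω ∉ L.lattice) :
    Tendsto (L.PhiFun ω) (𝓝[≠] 0) (Bornology.cobounded ℂ) := by
  have hσ := L.differentiable_sigmaFun.continuous
  have hne : L.sigmaFun ω ≠ 0 := L.sigmaFun_eq_zero_iff.not.mpr hω
  have h0 : ContinuousAt (fun z ↦ (L.PhiFun ω z)⁻¹) 0 := by
    simp only [PhiFun, inv_div]
    have : L.sigmaFun (0 + ω) * Complex.exp (-L.zetaFun ω * 0) ≠ 0 := by simpa using hne
    fun_prop (disch := assumption)
  have h1 : Tendsto (fun z ↦ (L.PhiFun ω z)⁻¹) (𝓝[≠] 0) (𝓝[≠] 0) := by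
    refine tendsto_nhdsWithin_iff.mpr ⟨?_, ?_⟩
    · have := h0.tendsto.mono_left (nhdsWithin_le_nhds (s := {0}ᶜ))
      simpa [PhiFun] using this
    · have hcont : ContinuousAt (fun z : ℂ ↦ z + ω) 0 := by fun_prop
      have h3 := hcont.preimage_mem_nhds
        (L.isClosed_lattice.isOpen_compl.mem_nhds (by simpa using hω))
      filter_upwards [self_mem_nhdsWithin, mem_nhdsWithin_of_mem_nhds h3,
        mem_nhdsWithin_of_mem_nhds (L.compl_lattice_sdiff_singleton_mem_nhds 0)] with z hz h3 h4
      exact inv_ne_zero (PhiFun_ne_zero hω (fun h ↦ h4 ⟨h, hz⟩) h3)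
  exact (tendsto_inv₀_nhdsNE_zero.comp h1).congr fun z ↦ inv_inv _

end HalfPeriod

end PeriodPair

/-! ### Eisenstein series on the imaginary axis and lattices with prescribed invariants. -/

open UpperHalfPlane EisensteinSeries ModularForm in
lemma EisensteinSeries.tendsto_E_atImInfty {k : ℕ} (hk : 3 ≤ k) (hk2 : Even k) :
    Tendsto (E hk) atImInfty (𝓝 1) := by
  have han := ModularFormClass.analyticAt_cuspFunction_zero (E hk) one_pos one_mem_strictPeriods_SL
  have hper := SlashInvariantFormClass.periodic_comp_ofComplex (E hk) one_mem_strictPeriods_SL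
  have h0 : cuspFunction 1 (E hk) 0 = 1 := by
    rw [← E_qExpansion_coeff_zero hk hk2, qExpansion_coeff_zero one_pos han hper,
      cuspFunction_apply_zero one_pos han hper]
  have h1 := han.continuousAt.tendsto.comp (qParam_tendsto_atImInfty one_pos)
  rw [h0] at h1
  refine h1.congr fun τ ↦ ?_
  simpa using eq_cuspFunction τ one_ne_zero hper

open UpperHalfPlane ModularForm CongruenceSubgroup ModularGroup MatrixGroups in
-- The inversion S fixes i and acts in weight 6 by i⁶ = −1, so E₆(i) = −E₆(i).
lemma ModularForm.E₆_I : E₆ UpperHalfPlane.I = 0 := by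
  have : SlashInvariantFormClass (ModularForm 𝒮ℒ 6) Γ(1) 6 := Gamma_one_coe_eq_SL ▸ inferInstance
  have hI := SlashInvariantForm.slash_action_eqn_SL'' (E₆) (mem_Gamma_one S) UpperHalfPlane.I
  have hS : S • UpperHalfPlane.I = UpperHalfPlane.I := by
    rw [modular_S_smul]
    ext
    simp
  rw [hS, denom_S] at hI
  have h6 : ((UpperHalfPlane.I : ℍ) : ℂ) ^ (6 : ℤ) = -1 := by
    have : (6 : ℤ) = ((6 : ℕ) : ℤ) := rfl
    rw [this, zpow_natCast]
    rw [UpperHalfPlane.coe_I]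
    linear_combination (Complex.I ^ 4 - Complex.I ^ 2 + 1) * Complex.I_sq
  rw [h6] at hI
  have : (2 : ℂ) * E₆ UpperHalfPlane.I = 0 := by linear_combination hI
  simpa using this

/-- The point `i exp s` of the upper half plane. -/
noncomputable def imagAxis (s : ℝ) : UpperHalfPlane :=
  ⟨Complex.I * (Real.exp s : ℝ), by
    rw [Complex.I_mul_im, Complex.ofReal_re]
    exact Real.exp_pos s⟩

lemma continuous_imagAxis : Continuous imagAxis := by
  rw [UpperHalfPlane.isEmbedding_coe.continuous_iff]
  change Continuous fun s : ℝ ↦ Complex.I * ((Real.exp s : ℝ) : ℂ)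
  fun_prop

lemma tendsto_imagAxis : Tendsto imagAxis atTop UpperHalfPlane.atImInfty := by
  rw [UpperHalfPlane.atImInfty, tendsto_comap_iff]
  refine Real.tendsto_exp_atTop.congr fun s ↦ ?_
  rw [Function.comp_apply, imagAxis, UpperHalfPlane.im, Complex.I_mul_im, Complex.ofReal_re]

lemma imagAxis_zero : imagAxis 0 = UpperHalfPlane.I := by
  ext
  simp [imagAxis]

lemma cexp_two_pi_I_mul_imagAxis (s : ℝ) :
    Complex.exp (2 * Real.pi * Complex.I * imagAxis s) =
      (Real.exp (-(2 * Real.pi * Real.exp s)) : ℝ) := by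
  rw [Complex.ofReal_exp]
  congr 1
  simp only [imagAxis]
  push_cast
  linear_combination 2 * Real.pi * Complex.exp s * Complex.I_mul_I

open EisensteinSeries ModularForm in
lemma EisensteinSeries.E_imagAxis {k : ℕ} (hk : 3 ≤ k) (hk2 : Even k) (s : ℝ) :
    E hk (imagAxis s) = ((1 - (2 * k / bernoulli k) * ∑' n : ℕ+, (ArithmeticFunction.sigma (k - 1) n : ℝ) *
      Real.exp (-(2 * Real.pi * Real.exp s)) ^ (n : ℕ) : ℝ) : ℂ) := by
  rw [q_expansion_bernoulli hk hk2, cexp_two_pi_I_mul_imagAxis]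
  push_cast
  simp

open ModularForm in
-- Since B₄ = −1/30, E₄ = 1 + 240 Σ σ₃(n) qⁿ, and q is positive on the imaginary axis.
lemma ModularForm.exists_re_E₄ (s : ℝ) : ∃ x : ℝ, 1 ≤ x ∧ E₄ (imagAxis s) = x := by
  refine ⟨_, ?_, EisensteinSeries.E_imagAxis (by norm_num) ⟨2, rfl⟩ s⟩
  rw [show bernoulli 4 = -1 / 30 by decide +kernel]
  have : 0 ≤ ∑' n : ℕ+, (ArithmeticFunction.sigma (4 - 1) n : ℝ) *
      Real.exp (-(2 * Real.pi * Real.exp s)) ^ (n : ℕ) :=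
    tsum_nonneg fun n ↦ by positivity
  norm_num at this ⊢
  linarith

open ModularForm in
/-- On the imaginary axis, `E₆² / E₄³` takes all the values of `(0, 1)`. -/
lemma ModularForm.exists_E₆_sq_eq_mul_E₄_cube {c : ℝ} (hc0 : 0 < c) (hc1 : c < 1) :
    ∃ s : ℝ, E₆ (imagAxis s) ^ 2 = c * E₄ (imagAxis s) ^ 3 := by
  have h4 := fun s ↦ ModularForm.exists_re_E₄ s
  choose x hx1 hx using h4
  obtain ⟨y, hy⟩ : ∃ y : ℝ → ℝ, ∀ s, E₆ (imagAxis s) = y s :=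
    ⟨_, fun s ↦ EisensteinSeries.E_imagAxis (by norm_num) ⟨3, rfl⟩ s⟩
  have hxr : x = fun s ↦ (E₄ (imagAxis s)).re := funext fun s ↦ by rw [hx]; simp
  have hyr : y = fun s ↦ (E₆ (imagAxis s)).re := funext fun s ↦ by rw [hy]; simp
  have hxc : Continuous x := by
    rw [hxr]
    exact Complex.continuous_re.comp ((ModularFormClass.continuous E₄).comp continuous_imagAxis)
  have hyc : Continuous y := by
    rw [hyr]
    exact Complex.continuous_re.comp ((ModularFormClass.continuous E₆).comp continuous_imagAxis)
  have hxt : Tendsto x atTop (𝓝 1) := by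
    rw [hxr]
    exact (Complex.continuous_re.tendsto 1).comp
      ((EisensteinSeries.tendsto_E_atImInfty _ ⟨2, rfl⟩).comp tendsto_imagAxis)
  have hyt : Tendsto y atTop (𝓝 1) := by
    rw [hyr]
    exact (Complex.continuous_re.tendsto 1).comp
      ((EisensteinSeries.tendsto_E_atImInfty _ ⟨3, rfl⟩).comp tendsto_imagAxis)
  have ht : Tendsto (fun s ↦ y s ^ 2 - c * x s ^ 3) atTop (𝓝 (1 ^ 2 - c * 1 ^ 3)) :=
    (hyt.pow 2).sub ((hxt.pow 3).const_mul c)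
  obtain ⟨s₁, hs₁⟩ := (ht.eventually_const_lt (u := 0) (by linarith)).exists
  -- The parameter 0 is the point i, where E₆ = 0 and E₄ > 0. At i∞ the expression tends to 1 − c >
  -- 0, so the intermediate value theorem applies.
  have h0 : y 0 ^ 2 - c * x 0 ^ 3 ≤ 0 := by
    have : y 0 = 0 := by
      have := hy 0
      rw [imagAxis_zero, E₆_I] at this
      exact_mod_cast this.symm
    have hx0 : 0 < x 0 := by linarith [hx1 0]
    rw [this]
    have : 0 < c * x 0 ^ 3 := by positivity
    linarith
  obtain ⟨s, hs⟩ := mem_range_of_exists_le_of_exists_ge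
    (f := fun s ↦ y s ^ 2 - c * x s ^ 3) (c := 0) (by fun_prop) ⟨0, h0⟩ ⟨s₁, hs₁.le⟩
  refine ⟨s, ?_⟩
  rw [hx, hy]
  have : y s ^ 2 = c * x s ^ 3 := by linarith
  exact_mod_cast this

namespace PeriodPair

/-- The period pair `(c τ, c)`. -/
noncomputable def ofTau (τ : UpperHalfPlane) {c : ℂ} (hc : c ≠ 0) : PeriodPair where
  ω₁ := c * τ
  ω₂ := c
  indep := by
    rw [LinearIndependent.pair_iff]
    intro s t h
    have h1 : (s : ℂ) * τ + t = 0 := by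
      refine mul_left_cancel₀ hc ?_
      simp only [Complex.real_smul] at h
      linear_combination h
    have h2 := congrArg Complex.im h1
    have h3 := congrArg Complex.re h1
    simp [τ.im_pos.ne'] at h2 h3
    simp_all

open EisensteinSeries ModularForm in
lemma G_ofTau (τ : UpperHalfPlane) {c : ℂ} (hc : c ≠ 0) {k : ℕ} (hk : 3 ≤ k) :
    (ofTau τ hc).G k = (c ^ k)⁻¹ * (2 * riemannZeta k * E hk τ) := by
  have h1 : E hk τ = (1 / 2 : ℂ) * eisensteinSeries (N := 1) 0 k τ := rfl
  have h2 : 2 * riemannZeta k * E hk τ = ∑' v : Fin 2 → ℤ, eisSummand k v τ := by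
    rw [tsum_eisSummand_eq_riemannZeta_mul_eisensteinSeries hk, h1]
    ring
  rw [h2, G, ← (ofTau τ hc).latticeEquivProd.symm.toEquiv.tsum_eq,
    ← (finTwoArrowEquiv ℤ).symm.tsum_eq, ← tsum_mul_left]
  refine tsum_congr fun x ↦ ?_
  have h3 : (((ofTau τ hc).latticeEquivProd.symm.toEquiv x : (ofTau τ hc).lattice) : ℂ) =
      x.1 * (c * τ) + x.2 * c := latticeEquiv_symm_apply _ x
  rw [h3]
  simp only [finTwoArrowEquiv_symm_apply,
    eisSummand, Matrix.cons_val_zero, Matrix.cons_val_one, zpow_neg, zpow_natCast]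
  rw [← mul_inv, ← mul_pow]
  ring_nf

lemma riemannZeta_six : riemannZeta 6 = (Real.pi : ℂ) ^ 6 / 945 := by
  have := riemannZeta_two_mul_nat (k := 3) (by norm_num)
  rw [show bernoulli (2 * 3) = 1 / 42 by decide +kernel] at this
  norm_num [Nat.factorial] at this
  rw [this]
  ring

open ModularForm in
lemma g₂_ofTau (τ : UpperHalfPlane) {c : ℂ} (hc : c ≠ 0) :
    (ofTau τ hc).g₂ = 4 / 3 * Real.pi ^ 4 * E₄ τ / c ^ 4 := by
  rw [g₂, G_ofTau τ hc (by norm_num : 3 ≤ 4)]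
  push_cast
  rw [riemannZeta_four]
  ring

open ModularForm in
lemma g₃_ofTau (τ : UpperHalfPlane) {c : ℂ} (hc : c ≠ 0) :
    (ofTau τ hc).g₃ = 8 / 27 * Real.pi ^ 6 * E₆ τ / c ^ 6 := by
  rw [g₃, G_ofTau τ hc (by norm_num : 3 ≤ 6)]
  push_cast
  rw [riemannZeta_six]
  ring

open ModularForm in
/-- Real invariants `g₂ > 0` and `g₃ ≠ 0` of positive discriminant are those of some lattice. -/
lemma exists_g₂_g₃_eq {a b : ℝ} (ha : 0 < a) (hb : b ≠ 0) (hab : 27 * b ^ 2 < a ^ 3) :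
    ∃ L : PeriodPair, L.g₂ = a ∧ L.g₃ = b := by
  have ha3 : 0 < a ^ 3 := by positivity
  obtain ⟨s, hs⟩ := exists_E₆_sq_eq_mul_E₄_cube (c := 27 * b ^ 2 / a ^ 3) (by positivity)
    ((div_lt_one ha3).mpr hab)
  obtain ⟨x, hx1, hx⟩ := exists_re_E₄ s
  have hx0 : x ≠ 0 := by linarith
  set τ := imagAxis s
  have hpi : (Real.pi : ℂ) ≠ 0 := by exact_mod_cast Real.pi_ne_zero
  have haC : (a : ℂ) ≠ 0 := by exact_mod_cast ha.ne'
  have hxC : (x : ℂ) ≠ 0 := by exact_mod_cast hx0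
  have hbC : (b : ℂ) ≠ 0 := by exact_mod_cast hb
  -- This scale makes g₂ equal to a, and the choice of s then gives g₃² = b². Multiplying c by i
  -- keeps g₂ and changes the sign of g₃.
  obtain ⟨c, hc⟩ := IsAlgClosed.exists_pow_nat_eq (4 / 3 * Real.pi ^ 4 * x / a : ℂ)
    (n := 4) (by norm_num)
  have hc0 : c ≠ 0 := by
    rintro rfl
    have : (4 / 3 * Real.pi ^ 4 * x / a : ℂ) ≠ 0 := by simp [hpi, haC, hxC]
    exact this (by rw [← hc]; simp)
  have hg2 : ∀ d : ℂ, ∀ hd : d ≠ 0, d ^ 4 = c ^ 4 → (ofTau τ hd).g₂ = a := by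
    intro d hd h
    rw [g₂_ofTau, h, hc, hx]
    field_simp
  have hsq : (8 / 27 * Real.pi ^ 6 * E₆ τ / c ^ 6 : ℂ) ^ 2 = b ^ 2 := by
    rw [hx] at hs
    have h12 : (c ^ 6) ^ 2 = (4 / 3 * Real.pi ^ 4 * x / a : ℂ) ^ 3 := by
      rw [← hc]
      ring
    rw [div_pow, h12, mul_pow, hs]
    push_cast
    field_simp
    ring
  rcases sq_eq_sq_iff_eq_or_eq_neg.mp hsq with h | h
  · exact ⟨ofTau τ hc0, hg2 c hc0 rfl, by rw [g₃_ofTau, h]⟩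
  · have hd : Complex.I * c ≠ 0 := mul_ne_zero Complex.I_ne_zero hc0
    refine ⟨ofTau τ hd, hg2 _ hd ?_, ?_⟩
    · rw [mul_pow, Complex.I_pow_four, one_mul]
    · rw [g₃_ofTau, mul_pow, show Complex.I ^ 6 = -1 by
        rw [show 6 = 2 * 3 from rfl, pow_mul, Complex.I_sq]; norm_num, neg_one_mul, div_neg, h,
        neg_neg]

lemma sqrt_six_sq : (((√6 : ℝ) : ℂ)) ^ 2 = 6 := by
  rw [← Complex.ofReal_pow, Real.sq_sqrt (by norm_num)]
  norm_num

lemma sqrt_six_ne_zero : (((√6 : ℝ) : ℂ)) ≠ 0 := by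
  intro h
  have := sqrt_six_sq
  rw [h] at this
  norm_num at this

lemma rpow_six_sq : ((((6 : ℝ) ^ (1 / 4 : ℝ) : ℝ) : ℂ)) ^ 2 = ((√6 : ℝ) : ℂ) := by
  rw [← Complex.ofReal_pow, ← Real.rpow_natCast, ← Real.rpow_mul (by norm_num), Real.sqrt_eq_rpow]
  norm_num

/-- Surjectivity of ℘ supplies ω and κ. The Weierstrass equation gives ℘'(ω) = 0, which makes ω a
half-period, and fixes ℘'(κ) up to a sign absorbed by κ ↦ −κ. -/
lemma exists_isSomosLattice : ∃ (L : PeriodPair) (ω κ : ℂ), IsSomosLattice L ω κ := by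
  have h6 : (0 : ℝ) < √6 := by positivity
  have h6s : √6 ^ 2 = 6 := Real.sq_sqrt (by norm_num)
  obtain ⟨L, h2, h3⟩ := exists_g₂_g₃_eq (a := 121 / 72) (b := -845 / (1296 * √6)) (by norm_num)
    (div_ne_zero (by norm_num) (by positivity))
    (by rw [div_pow, mul_pow, h6s]; norm_num)
  push_cast at h2 h3
  have hs := sqrt_six_sq
  have hs0 := sqrt_six_ne_zero
  obtain ⟨ω, hω, hω1⟩ := L.exists_weierstrassP_eq (5 / (12 * ((√6 : ℝ) : ℂ)))
  have hω' : L.derivWeierstrassP ω = 0 := by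
    have := L.derivWeierstrassP_sq ω hω
    rw [hω1, h2, h3] at this
    rw [← sq_eq_zero_iff, this]
    field_simp
    rw [hs]
    norm_num
  obtain ⟨κ, hκ, hκ1⟩ := L.exists_weierstrassP_eq (29 / (12 * ((√6 : ℝ) : ℂ)))
  have hκ' : L.derivWeierstrassP κ ^ 2 = ((((6 : ℝ) ^ (1 / 4 : ℝ) : ℝ) : ℂ)) ^ 2 := by
    have := L.derivWeierstrassP_sq κ hκ
    rw [hκ1, h2, h3] at this
    rw [this, rpow_six_sq]
    field_simp
    rw [show ((√6 : ℝ) : ℂ) ^ 4 = (((√6 : ℝ) : ℂ) ^ 2) ^ 2 by ring, hs]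
    norm_num
  have hmem := (L.derivWeierstrassP_eq_zero_iff hω).mp hω'
  rcases sq_eq_sq_iff_eq_or_eq_neg.mp hκ' with h | h
  · exact ⟨L, ω, κ, h2, h3, hω, hmem, hω1, hω', hκ1, h⟩
  · exact ⟨L, ω, -κ, h2, h3, hω, hmem, hω1, hω', by rw [weierstrassP_neg, hκ1],
      by rw [derivWeierstrassP_neg, h, neg_neg]⟩

end PeriodPair

/-! ### Algebra of the three-term, biquadratic and Somos-5 relations. -/

section SomosAlgebra

variable {𝕜 : Type*} [Field 𝕜]

/-- The relation between three consecutive terms `(S, T)`, the middle one of even index. -/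
def EvenStep (a b a₁ b₁ a₂ b₂ : 𝕜) : Prop :=
  a₂ * a = a₁ ^ 2 + b₁ ^ 2 ∧ b₂ * b = 2 * b₁ ^ 2 - a₁ ^ 2

/-- The relation between three consecutive terms `(S, T)`, the middle one of odd index. -/
def OddStep (a b a₁ b₁ a₂ b₂ : 𝕜) : Prop :=
  3 * (a₂ * a) = 2 * a₁ ^ 2 + b₁ ^ 2 ∧ 3 * (b₂ * b) = b₁ ^ 2 - a₁ ^ 2

/-- The biquadratic relation between a term `(a, b)` of even index and a neighbour `(c, d)`. -/
def CurveRel (a b c d : 𝕜) : Prop :=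
  (d ^ 2 - c ^ 2) * a ^ 2 + 3 * (a * b * c * d) + (2 * c ^ 2 + d ^ 2) * b ^ 2 = 0

variable {a₀ a₁ a₂ a₃ a₄ a₅ b₀ b₁ b₂ b₃ b₄ b₅ : 𝕜}

lemma EvenStep.symm (h : EvenStep a₀ b₀ a₁ b₁ a₂ b₂) : EvenStep a₂ b₂ a₁ b₁ a₀ b₀ :=
  ⟨by rw [mul_comm, h.1], by rw [mul_comm, h.2]⟩

lemma OddStep.symm (h : OddStep a₀ b₀ a₁ b₁ a₂ b₂) : OddStep a₂ b₂ a₁ b₁ a₀ b₀ :=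
  ⟨by rw [mul_comm a₀, h.1], by rw [mul_comm b₀, h.2]⟩

/-- With the middle ratio fixed, the biquadratic is quadratic in its neighbour. One root and the
product of the roots being known, this is Vieta's formula for their sum. -/
lemma EvenStep.cross (h : EvenStep a₀ b₀ a₁ b₁ a₂ b₂) (hK : CurveRel a₁ b₁ a₀ b₀) (ha : a₀ ≠ 0)
    (hb : b₀ ≠ 0) : a₂ * b₀ + a₀ * b₂ + 3 * (a₁ * b₁) = 0 := by
  refine mul_left_cancel₀ (mul_ne_zero ha hb) ?_
  have := hK
  rw [CurveRel] at this
  linear_combination this + b₀ ^ 2 * h.1 + a₀ ^ 2 * h.2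

/-- The known product and sum of roots show that the other neighbour is a root too. -/
lemma EvenStep.curveRel (h : EvenStep a₀ b₀ a₁ b₁ a₂ b₂) (hK : CurveRel a₁ b₁ a₀ b₀) (ha : a₀ ≠ 0)
    (hb : b₀ ≠ 0) : CurveRel a₁ b₁ a₂ b₂ := by
  have hc := h.cross hK ha hb
  rw [CurveRel]
  linear_combination a₂ * b₂ * hc - b₂ ^ 2 * h.1 - a₂ ^ 2 * h.2

variable [CharZero 𝕜]

lemma OddStep.cross (h : OddStep a₀ b₀ a₁ b₁ a₂ b₂) (hK : CurveRel a₀ b₀ a₁ b₁) (ha : a₀ ≠ 0)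
    (hb : b₀ ≠ 0) : a₂ * b₀ + a₀ * b₂ + a₁ * b₁ = 0 := by
  refine mul_left_cancel₀ (mul_ne_zero three_ne_zero (mul_ne_zero ha hb)) ?_
  have := hK
  rw [CurveRel] at this
  linear_combination this + b₀ ^ 2 * h.1 + a₀ ^ 2 * h.2

lemma OddStep.curveRel (h : OddStep a₀ b₀ a₁ b₁ a₂ b₂) (hK : CurveRel a₀ b₀ a₁ b₁) (ha : a₀ ≠ 0)
    (hb : b₀ ≠ 0) : CurveRel a₂ b₂ a₁ b₁ := by
  have hc := h.cross hK ha hb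
  rw [CurveRel]
  linear_combination 3 * a₂ * b₂ * hc - b₂ ^ 2 * h.1 - a₂ ^ 2 * h.2

/-- The bilinear relations between four consecutive terms. -/
lemma CurveRel.fourTerm (h₁ : EvenStep a₀ b₀ a₁ b₁ a₂ b₂) (h₂ : OddStep a₁ b₁ a₂ b₂ a₃ b₃)
    (hK : CurveRel a₁ b₁ a₂ b₂) (ha₁ : a₁ ≠ 0) (ha₂ : a₂ ≠ 0) (hb₁ : b₁ ≠ 0) (hb₂ : b₂ ≠ 0) :
    a₃ * a₀ = a₂ * a₁ - b₂ * b₁ ∧ b₃ * b₀ = b₂ * b₁ + a₂ * a₁ := by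
  rw [CurveRel] at hK
  constructor
  · refine mul_left_cancel₀ (mul_ne_zero three_ne_zero (mul_ne_zero ha₁ ha₂)) ?_
    linear_combination hK + (2 * a₂ ^ 2 + b₂ ^ 2) * h₁.1 + a₂ * a₀ * h₂.1
  · refine mul_left_cancel₀ (mul_ne_zero three_ne_zero (mul_ne_zero hb₁ hb₂)) ?_
    linear_combination -hK + (b₂ ^ 2 - a₂ ^ 2) * h₁.2 + b₂ * b₀ * h₂.2

/-- The Somos-5 relation, from the three-term relations. -/
lemma CurveRel.somosFive (h₁ : OddStep a₀ b₀ a₁ b₁ a₂ b₂) (h₂ : EvenStep a₁ b₁ a₂ b₂ a₃ b₃)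
    (h₃ : OddStep a₂ b₂ a₃ b₃ a₄ b₄) (h₄ : EvenStep a₃ b₃ a₄ b₄ a₅ b₅)
    (hK₁ : CurveRel a₂ b₂ a₁ b₁) (hK₂ : CurveRel a₂ b₂ a₃ b₃) (hK₃ : CurveRel a₄ b₄ a₃ b₃)
    (ha₁ : a₁ ≠ 0) (ha₂ : a₂ ≠ 0) (ha₃ : a₃ ≠ 0) (ha₄ : a₄ ≠ 0)
    (hb₁ : b₁ ≠ 0) (hb₂ : b₂ ≠ 0) (hb₃ : b₃ ≠ 0) (hb₄ : b₄ ≠ 0) :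
    a₅ * a₀ = a₄ * a₁ + a₃ * a₂ ∧ b₅ * b₀ = b₄ * b₁ + b₃ * b₂ := by
  have f₁ := fourTerm h₂.symm h₁.symm hK₁ ha₂ ha₁ hb₂ hb₁
  have f₂ := fourTerm h₂ h₃ hK₂ ha₂ ha₃ hb₂ hb₃
  have f₃ := fourTerm h₄.symm h₃.symm hK₃ ha₄ ha₃ hb₄ hb₃
  -- This supplies the mixed terms that appear when the four-term relations `f₁` and `f₃` are
  -- multiplied; the remaining terms are matched by `f₂`.
  have key : a₁ * a₂ * (b₃ * b₄) + b₁ * b₂ * (a₃ * a₄) =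
      (b₂ * b₃) ^ 2 + a₂ * a₃ * (b₂ * b₃) - (a₂ * a₃) ^ 2 := by
    rw [CurveRel] at hK₂
    refine mul_left_cancel₀ (mul_ne_zero three_ne_zero (mul_ne_zero (mul_ne_zero ha₂ ha₃)
      (mul_ne_zero hb₂ hb₃))) ?_
    linear_combination 3 * a₂ ^ 2 * b₃ ^ 2 * b₂ * b₄ * h₂.1 +
      (a₂ ^ 2 + b₂ ^ 2) * a₂ ^ 2 * b₃ ^ 2 * h₃.2 + 3 * b₂ ^ 2 * a₃ ^ 2 * a₂ * a₄ * h₂.2 +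
      (2 * b₂ ^ 2 - a₂ ^ 2) * b₂ ^ 2 * a₃ ^ 2 * h₃.1 -
      (a₂ ^ 2 * a₃ ^ 2 - b₂ ^ 2 * b₃ ^ 2 - a₂ ^ 2 * b₃ ^ 2 - 2 * b₂ ^ 2 * a₃ ^ 2 +
        3 * (a₂ * a₃ * (b₂ * b₃)) + b₂ ^ 2 * b₃ ^ 2 - a₂ ^ 2 * a₃ ^ 2) * hK₂
  constructor
  · refine mul_left_cancel₀ (mul_ne_zero ha₂ ha₃) ?_
    linear_combination a₅ * a₂ * f₁.1 + (a₁ * a₂ - b₁ * b₂) * f₃.1 - key +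
      b₂ * b₃ * f₂.2
  · refine mul_left_cancel₀ (mul_ne_zero hb₂ hb₃) ?_
    linear_combination b₅ * b₂ * f₁.2 + (b₁ * b₂ + a₁ * a₂) * f₃.2 + key +
      a₂ * a₃ * f₂.1

end SomosAlgebra

/-! ### The two Somos sequences at nonnegative indices. -/

lemma somosSNat_add_five (n : ℕ) : somosSNat (n + 5) =
    (somosSNat (n + 4) * somosSNat (n + 1) + somosSNat (n + 3) * somosSNat (n + 2)) /
      somosSNat n := rfl

lemma somosTNat_add_six (n : ℕ) : somosTNat (n + 6) =
    (somosTNat (n + 5) * somosTNat (n + 2) + somosTNat (n + 4) * somosTNat (n + 3)) /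
      somosTNat (n + 1) := rfl

lemma somosSNat_pos : ∀ n, 0 < somosSNat n
  | 0 | 1 | 2 | 3 | 4 => by norm_num [somosSNat]
  | n + 5 => by
    have h0 := somosSNat_pos n
    have h1 := somosSNat_pos (n + 1)
    have h2 := somosSNat_pos (n + 2)
    have h3 := somosSNat_pos (n + 3)
    have h4 := somosSNat_pos (n + 4)
    rw [somosSNat_add_five]
    positivity

/-- The three-term relation between the terms of index `n`, `n + 1`, `n + 2`. -/
def SomosStep (n : ℕ) : Prop :=
  (Odd n → EvenStep (somosSNat n) (somosTNat n) (somosSNat (n + 1)) (somosTNat (n + 1))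
    (somosSNat (n + 2)) (somosTNat (n + 2))) ∧
  (Even n → OddStep (somosSNat n) (somosTNat n) (somosSNat (n + 1)) (somosTNat (n + 1))
    (somosSNat (n + 2)) (somosTNat (n + 2)))

/-- The biquadratic relation between the terms of index `n` and `n + 1`. -/
def SomosCurveRel (n : ℕ) : Prop :=
  (Even n → CurveRel (somosSNat n) (somosTNat n) (somosSNat (n + 1)) (somosTNat (n + 1))) ∧
  (Odd n → CurveRel (somosSNat (n + 1)) (somosTNat (n + 1)) (somosSNat n) (somosTNat n))

lemma SomosStep.curveRel {n : ℕ} (h : SomosStep n) (hK : SomosCurveRel n)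
    (ht : somosTNat n ≠ 0) : SomosCurveRel (n + 1) := by
  have hs := (somosSNat_pos n).ne'
  refine ⟨fun hn ↦ ?_, fun hn ↦ ?_⟩
  · have hn : Odd n := by grind
    exact (h.1 hn).curveRel (hK.2 hn) hs ht
  · have hn : Even n := by grind
    exact (h.2 hn).curveRel (hK.1 hn) hs ht

/-- The next terms are defined provisionally by the three-term relation. `CurveRel.somosFive` shows
that they solve Somos-5, whose solution is unique after division, so they are the actual terms. -/
lemma SomosStep.next {n : ℕ} (h₂ : SomosStep (n + 1)) (h₃ : SomosStep (n + 2))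
    (h₄ : SomosStep (n + 3)) (hK : SomosCurveRel (n + 2)) (ht₁ : somosTNat (n + 1) ≠ 0)
    (ht₂ : somosTNat (n + 2) ≠ 0) (ht₃ : somosTNat (n + 3) ≠ 0) (ht₄ : somosTNat (n + 4) ≠ 0)
    (ht₅ : somosTNat (n + 5) ≠ 0) : SomosStep (n + 4) := by
  have hK₃ := h₃.curveRel hK ht₂
  have hK₄ := h₄.curveRel hK₃ ht₃
  have hs₁ := (somosSNat_pos (n + 1)).ne'
  have hs₂ := (somosSNat_pos (n + 2)).ne'
  have hs₃ := (somosSNat_pos (n + 3)).ne'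
  have hs₄ := (somosSNat_pos (n + 4)).ne'
  have hs₅ := (somosSNat_pos (n + 5)).ne'
  have hS : ∀ x, x * somosSNat (n + 1) = somosSNat (n + 5) * somosSNat (n + 2) +
      somosSNat (n + 4) * somosSNat (n + 3) → somosSNat (n + 6) = x := by
    intro x hx
    rw [show n + 6 = n + 1 + 5 from rfl, somosSNat_add_five, div_eq_iff hs₁, hx]
  have hT : ∀ x, x * somosTNat (n + 1) = somosTNat (n + 5) * somosTNat (n + 2) +
      somosTNat (n + 4) * somosTNat (n + 3) → somosTNat (n + 6) = x := by
    intro x hx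
    rw [somosTNat_add_six, div_eq_iff ht₁, hx]
  refine ⟨fun hn ↦ ?_, fun hn ↦ ?_⟩
  · have h₅ : EvenStep (somosSNat (n + 4)) (somosTNat (n + 4)) (somosSNat (n + 5))
        (somosTNat (n + 5)) ((somosSNat (n + 5) ^ 2 + somosTNat (n + 5) ^ 2) / somosSNat (n + 4))
        ((2 * somosTNat (n + 5) ^ 2 - somosSNat (n + 5) ^ 2) / somosTNat (n + 4)) :=
      ⟨div_mul_cancel₀ _ hs₄, div_mul_cancel₀ _ ht₄⟩
    have := CurveRel.somosFive (h₂.2 (by grind)) (h₃.1 (by grind)) (h₄.2 (by grind)) h₅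
      (hK.2 (by grind)) (hK₃.1 (by grind)) (hK₄.2 (by grind)) hs₂ hs₃ hs₄ hs₅ ht₂ ht₃ ht₄ ht₅
    rw [hS _ this.1, hT _ this.2]
    exact h₅
  · have h₅ : OddStep (somosSNat (n + 4)) (somosTNat (n + 4)) (somosSNat (n + 5))
        (somosTNat (n + 5))
        ((2 * somosSNat (n + 5) ^ 2 + somosTNat (n + 5) ^ 2) / (3 * somosSNat (n + 4)))
        ((somosTNat (n + 5) ^ 2 - somosSNat (n + 5) ^ 2) / (3 * somosTNat (n + 4))) := by
      constructor <;> field_simp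
    -- `CurveRel.somosFive` starts with an odd step; in this parity the six terms are read
    -- backwards.
    have := CurveRel.somosFive h₅.symm (h₄.1 (by grind)).symm (h₃.2 (by grind)).symm
      (h₂.1 (by grind)).symm
      (hK₄.1 (by grind)) (hK₃.2 (by grind)) (hK.1 (by grind)) hs₅ hs₄ hs₃ hs₂ ht₅ ht₄ ht₃ ht₂
    have e₁ := hS _ ((mul_comm _ _).trans (this.1.trans (by ring)))
    have e₂ := hT _ ((mul_comm _ _).trans (this.2.trans (by ring)))
    rw [e₁, e₂]
    exact h₅

/-! ### Comparison of the Somos ratios with a solution of their recurrence. -/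

/-- A complex sequence `f` with the same recurrence as the ratios of the two Somos sequences. -/
structure IsSomosRatio (f : ℕ → ℂ) : Prop where
  one : f 1 = 1
  two : f 2 = -1
  even_ne : ∀ n, Even n → 2 ≤ n → f n ^ 2 ≠ 2
  odd_ne : ∀ n, Odd n → 2 ≤ n → f n ^ 2 ≠ 1
  even : ∀ n, Odd n → f (n + 2) * f n * (2 - f (n + 1) ^ 2) = 1 + f (n + 1) ^ 2
  odd : ∀ n, Even n → 2 ≤ n → f (n + 2) * f n * (1 - f (n + 1) ^ 2) = 1 + 2 * f (n + 1) ^ 2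

/-- A zero of T at n + 2 would force f(n+1)² to be 2 or 1, the values that f avoids. Then both
ratios solve the same recurrence and agree. -/
lemma IsSomosRatio.ratio {f : ℕ → ℂ} (hf : IsSomosRatio f) {n : ℕ} (hn : 1 ≤ n)
    (h : SomosStep n) (ht₀ : somosTNat n ≠ 0) (ht₁ : somosTNat (n + 1) ≠ 0)
    (hf₀ : (somosSNat n : ℂ) / somosTNat n = f n)
    (hf₁ : (somosSNat (n + 1) : ℂ) / somosTNat (n + 1) = f (n + 1)) :
    somosTNat (n + 2) ≠ 0 ∧ (somosSNat (n + 2) : ℂ) / somosTNat (n + 2) = f (n + 2) := by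
  have hs₀ : (somosSNat n : ℂ) ≠ 0 := by exact_mod_cast (somosSNat_pos n).ne'
  have ht₀' : (somosTNat n : ℂ) ≠ 0 := by exact_mod_cast ht₀
  have ht₁' : (somosTNat (n + 1) : ℂ) ≠ 0 := by exact_mod_cast ht₁
  rcases Nat.even_or_odd n with hn' | hn'
  · obtain ⟨h1, h2⟩ := h.2 hn'
    have h1' : 3 * ((somosSNat (n + 2) : ℂ) * somosSNat n) =
      2 * somosSNat (n + 1) ^ 2 + somosTNat (n + 1) ^ 2 := by exact_mod_cast h1
    have h2' : 3 * ((somosTNat (n + 2) : ℂ) * somosTNat n) =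
      somosTNat (n + 1) ^ 2 - somosSNat (n + 1) ^ 2 := by exact_mod_cast h2
    have hrec := hf.odd n hn' (by grind)
    have hne := hf.odd_ne (n + 1) (by grind) (by omega)
    rw [← hf₁, div_pow, ne_eq, div_eq_iff (pow_ne_zero 2 ht₁')] at hne
    have ht₂ : (somosTNat (n + 2) : ℂ) ≠ 0 := by
      intro h0
      rw [h0] at h2'
      exact hne (by linear_combination h2')
    refine ⟨by exact_mod_cast ht₂, ?_⟩
    rw [← hf₁, ← hf₀] at hrec
    field_simp at hrec
    have hne' : (somosTNat (n + 1) : ℂ) ^ 2 - somosSNat (n + 1) ^ 2 ≠ 0 :=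
      fun h0 ↦ hne (by linear_combination -h0)
    rw [div_eq_iff ht₂]
    refine mul_left_cancel₀ (mul_ne_zero hs₀ hne') ?_
    rw [← h2'] at hrec ⊢
    linear_combination ((somosTNat (n + 2) : ℂ) * somosTNat n) * h1' - somosTNat (n + 2) * hrec
  · obtain ⟨h1, h2⟩ := h.1 hn'
    have h1' : (somosSNat (n + 2) : ℂ) * somosSNat n =
      somosSNat (n + 1) ^ 2 + somosTNat (n + 1) ^ 2 := by exact_mod_cast h1
    have h2' : (somosTNat (n + 2) : ℂ) * somosTNat n =
      2 * somosTNat (n + 1) ^ 2 - somosSNat (n + 1) ^ 2 := by exact_mod_cast h2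
    have hrec := hf.even n hn'
    have hne := hf.even_ne (n + 1) (by grind) (by omega)
    rw [← hf₁, div_pow, ne_eq, div_eq_iff (pow_ne_zero 2 ht₁')] at hne
    have ht₂ : (somosTNat (n + 2) : ℂ) ≠ 0 := by
      intro h0
      rw [h0] at h2'
      exact hne (by linear_combination h2')
    refine ⟨by exact_mod_cast ht₂, ?_⟩
    rw [← hf₁, ← hf₀] at hrec
    field_simp at hrec
    have hne' : 2 * (somosTNat (n + 1) : ℂ) ^ 2 - somosSNat (n + 1) ^ 2 ≠ 0 :=
      fun h0 ↦ hne (by linear_combination -h0)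
    rw [div_eq_iff ht₂]
    refine mul_left_cancel₀ (mul_ne_zero hs₀ hne') ?_
    rw [← h2'] at hrec ⊢
    linear_combination ((somosTNat (n + 2) : ℂ) * somosTNat n) * h1' - somosTNat (n + 2) * hrec

lemma somosStep_of_lt_five {n : ℕ} (hn : n < 5) : SomosStep n := by
  interval_cases n <;> refine ⟨fun h ↦ ?_, fun h ↦ ?_⟩ <;> first
    | exact absurd h (by decide)
    | norm_num [EvenStep, OddStep, somosSNat, somosTNat]

lemma somosCurveRel_zero : SomosCurveRel 0 :=
  ⟨fun _ ↦ by norm_num [CurveRel, somosSNat, somosTNat], fun h ↦ absurd h (by decide)⟩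

/-- Index 1 needs its own check: passing from 0 to 1 by `SomosStep.curveRel` would require T₀ ≠ 0.
-/
lemma somosCurveRel_one : SomosCurveRel 1 :=
  ⟨fun h ↦ absurd h (by decide), fun _ ↦ by norm_num [CurveRel, somosSNat, somosTNat]⟩

/-- The claims are proved together: the step at n needs T to be nonzero up to n + 1, which comes
from the comparison with f, which in turn uses the step at n − 2 + 1 or earlier indices. -/
lemma IsSomosRatio.somos {f : ℕ → ℂ} (hf : IsSomosRatio f) (n : ℕ) :
    SomosStep n ∧ SomosCurveRel n ∧ somosTNat (n + 1) ≠ 0 ∧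
      (somosSNat (n + 1) : ℂ) / somosTNat (n + 1) = f (n + 1) := by
  induction n using Nat.strong_induction_on with
  | _ n ih =>
  have hratio : somosTNat (n + 1) ≠ 0 ∧
      (somosSNat (n + 1) : ℂ) / somosTNat (n + 1) = f (n + 1) := by
    match n with
    | 0 => simp [somosTNat, somosSNat, hf.one]
    | 1 => simp [somosTNat, somosSNat, hf.two]
    | n + 2 =>
      have h0 := ih n (by omega)
      have h1 := ih (n + 1) (by omega)
      exact hf.ratio (by omega) h1.1 h0.2.2.1 h1.2.2.1 h0.2.2.2 h1.2.2.2
  have hstep : SomosStep n := by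
    by_cases hn : n < 5
    · exact somosStep_of_lt_five hn
    · obtain ⟨m, rfl⟩ : ∃ m, n = m + 4 := ⟨n - 4, by omega⟩
      exact SomosStep.next (ih (m + 1) (by omega)).1 (ih (m + 2) (by omega)).1
        (ih (m + 3) (by omega)).1 (ih (m + 2) (by omega)).2.1 (ih m (by omega)).2.2.1
        (ih (m + 1) (by omega)).2.2.1 (ih (m + 2) (by omega)).2.2.1
        (ih (m + 3) (by omega)).2.2.1 hratio.1
  have hcurve : SomosCurveRel n := by
    match n with
    | 0 => exact somosCurveRel_zero
    | 1 => exact somosCurveRel_one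
    | n + 2 =>
      have h1 := ih (n + 1) (by omega)
      exact h1.1.curveRel h1.2.1 (ih n (by omega)).2.2.1
  exact ⟨hstep, hcurve, hratio⟩

/-! ### The point κ: its small multiples, its infinite order, and the recurrence for Φ(nκ). -/

/-- The coordinate `√6 (℘ z - ℘ ω)`. -/
noncomputable def PeriodPair.somosX (L : PeriodPair) (ω z : ℂ) : ℂ :=
  ((√6 : ℝ) : ℂ) * (L.weierstrassP z - L.weierstrassP ω)

namespace IsSomosLattice

open PeriodPair

variable {L : PeriodPair} {ω κ : ℂ}

/-- This is the constant (e − e')(e − e'') of the addition formulas, e = ℘(ω) and e', e'' being the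
other two roots of the Weierstrass cubic. -/
lemma three_mul_sq_sub (h : IsSomosLattice L ω κ) :
    3 * L.weierstrassP ω ^ 2 - L.g₂ / 4 = -1 / 3 := by
  have hs := sqrt_six_sq
  have hs0 := sqrt_six_ne_zero
  rw [h.weierstrassP_ω, h.g₂_eq]
  field_simp
  rw [hs]
  norm_num

lemma somosX_κ (h : IsSomosLattice L ω κ) : L.somosX ω κ = 2 := by
  have hs0 := sqrt_six_ne_zero
  rw [somosX, h.weierstrassP_κ, h.weierstrassP_ω]
  field_simp
  norm_num

lemma κ_notMem (h : IsSomosLattice L ω κ) : κ ∉ L.lattice := by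
  intro hκ
  have h1 := L.weierstrassP_coe ⟨κ, hκ⟩
  rw [h.weierstrassP_κ] at h1
  have hs0 := sqrt_six_ne_zero
  field_simp at h1
  norm_num at h1

lemma weierstrassP_sub_eq (z : ℂ) :
    L.weierstrassP z - L.weierstrassP ω = L.somosX ω z / ((√6 : ℝ) : ℂ) := by
  have hs0 := sqrt_six_ne_zero
  rw [somosX]
  field_simp

lemma somosX_eq_PhiFun_sq (h : IsSomosLattice L ω κ) {z : ℂ} (hz : z ∉ L.lattice) :
    L.somosX ω z = ((√6 : ℝ) : ℂ) * L.PhiFun ω z ^ 2 := by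
  rw [PhiFun_sq h.ω_notMem h.two_mul_ω_mem hz, somosX]

lemma somosX_eq_of_sub_mem {u v : ℂ} (huv : u - v ∈ L.lattice) :
    L.somosX ω u = L.somosX ω v := by
  have := L.weierstrassP_add_coe v ⟨_, huv⟩
  rw [show v + ((⟨u - v, huv⟩ : L.lattice) : ℂ) = u by simp] at this
  rw [somosX, this, somosX]

lemma add_ω_notMem {z : ℂ} (hz : L.somosX ω z ≠ 0) : z + ω ∉ L.lattice := by
  intro hmem
  have := somosX_eq_of_sub_mem (ω := ω) (u := z) (v := -ω) (by simpa using hmem)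
  rw [this, somosX, L.weierstrassP_neg, sub_self, mul_zero] at hz
  exact hz rfl

lemma derivWeierstrassP_sq_eq (h : IsSomosLattice L ω κ) {z : ℂ} (hz : z ∉ L.lattice) :
    6 * ((√6 : ℝ) : ℂ) * L.derivWeierstrassP z ^ 2 =
      L.somosX ω z * (4 * L.somosX ω z ^ 2 + 5 * L.somosX ω z - 8) := by
  have hs := sqrt_six_sq
  have hs0 := sqrt_six_ne_zero
  have h1 : L.weierstrassP z = (12 * L.somosX ω z + 5) / (12 * ((√6 : ℝ) : ℂ)) := by
    have := weierstrassP_sub_eq (L := L) (ω := ω) z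
    rw [h.weierstrassP_ω] at this
    rw [sub_eq_iff_eq_add] at this
    rw [this]
    field_simp
  rw [L.derivWeierstrassP_sq z hz, h1, h.g₂_eq, h.g₃_eq]
  field_simp
  rw [hs]
  ring

/-- The duplication formula for the coordinate `√6 (℘ z - ℘ ω)`. -/
lemma somosX_two_mul (h : IsSomosLattice L ω κ) {z : ℂ} (hz : z ∉ L.lattice)
    (hx : L.somosX ω z ≠ 0) (hx' : 4 * L.somosX ω z ^ 2 + 5 * L.somosX ω z - 8 ≠ 0) :
    2 * z ∉ L.lattice ∧
      L.somosX ω (2 * z) * (L.somosX ω z * (4 * L.somosX ω z ^ 2 + 5 * L.somosX ω z - 8)) =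
        (L.somosX ω z ^ 2 + 2) ^ 2 := by
  have hs := sqrt_six_sq
  have hs0 := sqrt_six_ne_zero
  have hp := h.derivWeierstrassP_sq_eq hz
  have h2 : 2 * z ∉ L.lattice := by
    rw [← L.derivWeierstrassP_eq_zero_iff hz]
    intro h0
    rw [h0] at hp
    refine mul_ne_zero hx hx' ?_
    rw [← hp]
    ring
  refine ⟨h2, ?_⟩
  have h3 := PhiFun_two_mul h.ω_notMem h.two_mul_ω_mem hz (add_ω_notMem hx) h2
  rw [h.three_mul_sq_sub, weierstrassP_sub_eq, div_pow, hs] at h3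
  rw [h.somosX_eq_PhiFun_sq h2, ← hp]
  have h4 : (L.PhiFun ω (2 * z) * L.derivWeierstrassP z) ^ 2 =
      (-1 / 3 - L.somosX ω z ^ 2 / 6) ^ 2 := by rw [h3]
  linear_combination 36 * h4 + 6 * L.PhiFun ω (2 * z) ^ 2 * L.derivWeierstrassP z ^ 2 * hs

/-- The addition formula for `Φ`, in terms of the coordinate `√6 (℘ z - ℘ ω)`. -/
lemma PhiFun_add_mul_PhiFun_sub_κ (h : IsSomosLattice L ω κ) {u : ℂ} (hu : u ∉ L.lattice)
    (hx : L.somosX ω u ≠ 0) (hadd : u + κ ∉ L.lattice) (hsub : u - κ ∉ L.lattice) :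
    3 * (L.PhiFun ω (u + κ) * L.PhiFun ω (u - κ) * (2 - L.somosX ω u)) =
      ((√6 : ℝ) : ℂ) * (L.somosX ω u + 1) := by
  have hs := sqrt_six_sq
  have hs0 := sqrt_six_ne_zero
  have h1 := PhiFun_add_mul_PhiFun_sub h.ω_notMem h.two_mul_ω_mem hu (add_ω_notMem hx) h.κ_notMem
    hadd hsub
  have h2 : L.weierstrassP κ - L.weierstrassP u = (2 - L.somosX ω u) / ((√6 : ℝ) : ℂ) := by
    rw [sub_div, ← h.somosX_κ, ← weierstrassP_sub_eq, ← weierstrassP_sub_eq]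
    ring
  rw [h.three_mul_sq_sub, h2, weierstrassP_sub_eq, weierstrassP_sub_eq, h.somosX_κ] at h1
  field_simp at h1
  refine mul_left_cancel₀ hs0 ?_
  linear_combination h1 + (-L.somosX ω u) * hs

/-- The coordinate takes the value x(κ) = 2 only at ±κ modulo the lattice. -/
lemma somosX_ne_two (h : IsSomosLattice L ω κ) {u : ℂ} (hu : u ∉ L.lattice)
    (hadd : u + κ ∉ L.lattice) (hsub : u - κ ∉ L.lattice) : L.somosX ω u ≠ 2 := by
  rw [← h.somosX_κ, somosX, somosX]
  intro h0
  have h1 := mul_left_cancel₀ sqrt_six_ne_zero h0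
  rw [sub_left_inj, L.weierstrassP_eq_iff hu h.κ_notMem] at h1
  exact h1.elim hsub hadd

lemma somosX_two_mul_κ (h : IsSomosLattice L ω κ) :
    2 * κ ∉ L.lattice ∧ L.somosX ω (2 * κ) = 1 := by
  have h1 := h.somosX_two_mul h.κ_notMem (by rw [h.somosX_κ]; norm_num)
    (by rw [h.somosX_κ]; norm_num)
  refine ⟨h1.1, ?_⟩
  have h2 := h1.2
  rw [h.somosX_κ] at h2
  linear_combination h2 / 36

/-- The addition formula at u = 2κ gives Φ(3κ)Φ(κ); squaring turns it into x(3κ)x(κ) = 16. -/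
lemma somosX_three_mul_κ (h : IsSomosLattice L ω κ) :
    3 * κ ∉ L.lattice ∧ L.somosX ω (3 * κ) = 8 := by
  have hs := sqrt_six_sq
  obtain ⟨h2, hx2⟩ := h.somosX_two_mul_κ
  have h3 : 2 * κ + κ ∉ L.lattice := by
    intro hmem
    have := somosX_eq_of_sub_mem (L := L) (ω := ω) (u := 2 * κ) (v := -κ) (by simpa using hmem)
    have hneg : L.somosX ω (-κ) = 2 := by rw [← h.somosX_κ, somosX, L.weierstrassP_neg, somosX]
    rw [hx2, hneg] at this
    norm_num at this
  have h4 := h.PhiFun_add_mul_PhiFun_sub_κ h2 (by rw [hx2]; norm_num) h3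
    (by rw [show 2 * κ - κ = κ by ring]; exact h.κ_notMem)
  rw [hx2, show 2 * κ + κ = 3 * κ by ring, show 2 * κ - κ = κ by ring] at h4
  rw [show 2 * κ + κ = 3 * κ by ring] at h3
  refine ⟨h3, ?_⟩
  have hκ := h.somosX_eq_PhiFun_sq h.κ_notMem
  rw [h.somosX_κ] at hκ
  have h5 := h.somosX_eq_PhiFun_sq h3
  have h6 : L.PhiFun ω (3 * κ) ^ 2 * L.PhiFun ω κ ^ 2 * 9 = 4 * 6 := by
    rw [← hs]
    linear_combination (3 * (L.PhiFun ω (3 * κ) * L.PhiFun ω κ * (2 - 1)) +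
      ((√6 : ℝ) : ℂ) * (1 + 1)) * h4
  have h7 : L.somosX ω (3 * κ) * 2 * 9 = 4 * 6 * 6 := by
    rw [h5]
    linear_combination 9 * ((√6 : ℝ) : ℂ) * L.PhiFun ω (3 * κ) ^ 2 * hκ + 6 * h6 +
      9 * L.PhiFun ω (3 * κ) ^ 2 * L.PhiFun ω κ ^ 2 * hs
  linear_combination h7 / 18

lemma somosX_six_mul_κ (h : IsSomosLattice L ω κ) :
    6 * κ ∉ L.lattice ∧ L.somosX ω (6 * κ) * 64 = 121 := by
  obtain ⟨h3, hx3⟩ := h.somosX_three_mul_κ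
  have h1 := h.somosX_two_mul h3 (by rw [hx3]; norm_num) (by rw [hx3]; norm_num)
  rw [show 2 * (3 * κ) = 6 * κ by ring, hx3] at h1
  refine ⟨h1.1, ?_⟩
  linear_combination h1.2 / 36

/-- The multiples `2 ^ k * 6 * κ` have coordinates of strictly decreasing `2`-adic valuation. -/
lemma exists_odd_somosX (h : IsSomosLattice L ω κ) (k : ℕ) :
    ((2 ^ k * 6 : ℕ) : ℂ) * κ ∉ L.lattice ∧ ∃ a b : ℤ, Odd a ∧ Odd b ∧
      L.somosX ω (((2 ^ k * 6 : ℕ) : ℂ) * κ) * (b * 4 ^ (k + 3)) = a := by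
  induction k with
  | zero =>
    obtain ⟨h1, h2⟩ := h.somosX_six_mul_κ
    refine ⟨by simpa using h1, 121, 1, by decide, by decide, ?_⟩
    norm_num
    exact h2
  | succ k ih =>
    obtain ⟨hz, a, b, ha, hb, hab⟩ := ih
    set z := ((2 ^ k * 6 : ℕ) : ℂ) * κ with hzdef
    set x := L.somosX ω z
    have hz2 : ((2 ^ (k + 1) * 6 : ℕ) : ℂ) * κ = 2 * z := by
      rw [hzdef]
      push_cast
      ring
    -- For x = a/(b 4^(k+3)), A and 4B are x² + 2 and 4x² + 5x − 8 multiplied by b² 16^(k+3). Both A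
    -- and B are odd because a is, so duplication lowers the valuation by exactly 2.
    set A : ℤ := a ^ 2 + 2 * b ^ 2 * 16 ^ (k + 3) with hA
    set B : ℤ := a ^ 2 + 5 * a * b * 4 ^ (k + 2) - 2 * b ^ 2 * 16 ^ (k + 3) with hB
    have hAodd : Odd A := ha.pow.add_even (((even_two.mul_right _).mul_right _))
    have h4e : Even ((4 : ℤ) ^ (k + 2)) := Even.pow_of_ne_zero (by decide) (by omega)
    have hBodd : Odd B :=
      (ha.pow.add_even (h4e.mul_left _)).sub_even ((even_two.mul_right _).mul_right _)
    have odd_ne {m : ℤ} (hm : Odd m) : (m : ℂ) ≠ 0 := by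
      have : m ≠ 0 := by
        rintro rfl
        exact absurd hm (by decide)
      exact_mod_cast this
    have ha0 := odd_ne ha
    have hb0 := odd_ne hb
    have hB0 := odd_ne hBodd
    have h16 : (16 : ℂ) ^ (k + 3) = (4 ^ (k + 3)) ^ 2 := by
      rw [← pow_mul, mul_comm, pow_mul]
      norm_num
    have hx0 : x ≠ 0 := by
      intro h0
      rw [h0, zero_mul] at hab
      exact ha0 hab.symm
    have hAx : (A : ℂ) = (x ^ 2 + 2) * (b * 4 ^ (k + 3)) ^ 2 := by
      rw [hA]
      push_cast
      rw [← hab, h16]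
      ring
    have hBx : 4 * (B : ℂ) = (4 * x ^ 2 + 5 * x - 8) * (b * 4 ^ (k + 3)) ^ 2 := by
      rw [hB]
      push_cast
      rw [← hab, h16]
      ring
    have hx1 : 4 * x ^ 2 + 5 * x - 8 ≠ 0 := by
      intro h0
      rw [h0, zero_mul] at hBx
      exact mul_ne_zero (by norm_num) hB0 hBx
    obtain ⟨h1, h2⟩ := h.somosX_two_mul hz hx0 hx1
    rw [hz2]
    refine ⟨h1, A ^ 2, a * b * B, hAodd.pow, (ha.mul hb).mul hBodd, ?_⟩
    push_cast
    rw [hAx, ← hab]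
    linear_combination (b : ℂ) ^ 4 * 4 ^ (4 * (k + 3)) * h2 +
      L.somosX ω (2 * z) * x * b ^ 2 * 4 ^ (2 * (k + 3)) * hBx

/-- If nκ were a period, two of the numbers 2^k · 6 would agree modulo n by pigeonhole, giving equal
coordinates with different 2-adic valuations. -/
lemma mul_κ_notMem (h : IsSomosLattice L ω κ) {n : ℤ} (hn : n ≠ 0) :
    (n : ℂ) * κ ∉ L.lattice := by
  intro hmem
  have : NeZero n.natAbs := ⟨Int.natAbs_ne_zero.mpr hn⟩
  obtain ⟨i, j, hij, heq⟩ : ∃ i j : ℕ, i < j ∧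
      ((2 ^ i * 6 : ℕ) : ZMod n.natAbs) = ((2 ^ j * 6 : ℕ) : ZMod n.natAbs) := by
    obtain ⟨i, j, hij, heq⟩ := Finite.exists_ne_map_eq_of_infinite
      fun k : ℕ ↦ ((2 ^ k * 6 : ℕ) : ZMod n.natAbs)
    rcases lt_or_gt_of_ne hij with h1 | h1
    · exact ⟨i, j, h1, heq⟩
    · exact ⟨j, i, h1, heq.symm⟩
  have hdvd : n ∣ ((2 ^ j * 6 : ℕ) : ℤ) - ((2 ^ i * 6 : ℕ) : ℤ) :=
    Int.natAbs_dvd.mp ((ZMod.natCast_eq_natCast_iff _ _ _).mp heq).dvd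
  obtain ⟨m, hm⟩ := hdvd
  have hmC : ((2 ^ j * 6 : ℕ) : ℂ) - ((2 ^ i * 6 : ℕ) : ℂ) = n * m := by exact_mod_cast hm
  have hsub : ((2 ^ j * 6 : ℕ) : ℂ) * κ - ((2 ^ i * 6 : ℕ) : ℂ) * κ ∈ L.lattice := by
    rw [← sub_mul, hmC, show (n : ℂ) * m * κ = m • (n * κ) by rw [zsmul_eq_mul]; ring]
    exact L.lattice.smul_mem m hmem
  have hx := somosX_eq_of_sub_mem (ω := ω) hsub
  obtain ⟨-, a, b, ha, hb, hab⟩ := h.exists_odd_somosX i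
  obtain ⟨-, c, d, hc, hd, hcd⟩ := h.exists_odd_somosX j
  rw [hx] at hcd
  obtain ⟨l, rfl⟩ := Nat.exists_eq_add_of_lt hij
  have key : a * d * 4 ^ (l + 1) = c * b := by
    have : (a : ℂ) * d * 4 ^ (l + 1) = c * b := by
      rw [← hab, ← hcd]
      ring
    exact_mod_cast this
  have hodd : Odd (c * b) := hc.mul hb
  rw [← key] at hodd
  have heven : Even (a * d * 4 ^ (l + 1)) :=
    (Even.pow_of_ne_zero (by decide) (by omega)).mul_left _
  exact (Int.not_even_iff_odd.mpr hodd) heven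

lemma natCast_mul_κ_notMem (h : IsSomosLattice L ω κ) {n : ℕ} (hn : n ≠ 0) :
    (n : ℂ) * κ ∉ L.lattice := by
  have := h.mul_κ_notMem (n := n) (by exact_mod_cast hn)
  simpa using this

/-- A zero would put nκ + ω in the lattice, hence also 2nκ. -/
lemma PhiFun_mul_κ_ne_zero (h : IsSomosLattice L ω κ) {n : ℕ} (hn : n ≠ 0) :
    L.PhiFun ω (n * κ) ≠ 0 := by
  refine PhiFun_ne_zero h.ω_notMem (h.natCast_mul_κ_notMem hn) fun hmem ↦ ?_
  have h1 := L.lattice.smul_mem (2 : ℤ) hmem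
  have h2 : (2 : ℤ) • ((n : ℂ) * κ + ω) - 2 * ω = ((2 * n : ℕ) : ℂ) * κ := by
    rw [zsmul_eq_mul]
    push_cast
    ring
  refine h.natCast_mul_κ_notMem (n := 2 * n) (by omega) ?_
  rw [← h2]
  exact sub_mem h1 h.two_mul_ω_mem

/-- The normalisation uses √6 Φ(κ)² = 2 and √6 Φ(2κ)² = 1. The excluded squares 2 (n even) and 1 (n
odd) both mean x(nκ) = 2. -/
lemma isSomosRatio (h : IsSomosLattice L ω κ) : IsSomosRatio fun n ↦
    if Even n then -(L.PhiFun ω (n * κ) / L.PhiFun ω (2 * κ)) else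
      L.PhiFun ω (n * κ) / L.PhiFun ω κ := by
  have hs := sqrt_six_sq
  have hs0 := sqrt_six_ne_zero
  have hκ : ((√6 : ℝ) : ℂ) * L.PhiFun ω κ ^ 2 = 2 := by
    rw [← h.somosX_eq_PhiFun_sq h.κ_notMem, h.somosX_κ]
  have h2κ : ((√6 : ℝ) : ℂ) * L.PhiFun ω (2 * κ) ^ 2 = 1 := by
    rw [← h.somosX_eq_PhiFun_sq h.somosX_two_mul_κ.1, h.somosX_two_mul_κ.2]
  have hκ0 : L.PhiFun ω κ ≠ 0 := by simpa using h.PhiFun_mul_κ_ne_zero one_ne_zero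
  have h2κ0 : L.PhiFun ω (2 * κ) ≠ 0 := by simpa using h.PhiFun_mul_κ_ne_zero two_ne_zero
  have hX {n : ℕ} (hn : n ≠ 0) := h.somosX_eq_PhiFun_sq (h.natCast_mul_κ_notMem hn)
  have hX0 {n : ℕ} (hn : n ≠ 0) : L.somosX ω (n * κ) ≠ 0 := by
    rw [hX hn]
    exact mul_ne_zero hs0 (pow_ne_zero _ (h.PhiFun_mul_κ_ne_zero hn))
  have heven {n : ℕ} (hn : n ≠ 0) :
      (-(L.PhiFun ω (n * κ) / L.PhiFun ω (2 * κ))) ^ 2 = L.somosX ω (n * κ) := by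
    rw [neg_sq, div_pow, div_eq_iff (pow_ne_zero _ h2κ0), hX hn]
    linear_combination -L.PhiFun ω (n * κ) ^ 2 * h2κ
  have hodd {n : ℕ} (hn : n ≠ 0) :
      2 * (L.PhiFun ω (n * κ) / L.PhiFun ω κ) ^ 2 = L.somosX ω (n * κ) := by
    rw [div_pow, mul_div_assoc', div_eq_iff (pow_ne_zero _ hκ0), hX hn]
    linear_combination -L.PhiFun ω (n * κ) ^ 2 * hκ
  have hadd (n : ℕ) : ((n + 1 : ℕ) : ℂ) * κ + κ = ((n + 2 : ℕ) : ℂ) * κ := by push_cast; ring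
  have hsub (n : ℕ) : ((n + 1 : ℕ) : ℂ) * κ - κ = (n : ℂ) * κ := by push_cast; ring
  have hne2 {n : ℕ} (hn : 2 ≤ n) : L.somosX ω (n * κ) ≠ 2 := by
    obtain ⟨m, rfl⟩ : ∃ m, n = m + 1 := ⟨n - 1, by omega⟩
    refine h.somosX_ne_two (h.natCast_mul_κ_notMem (by omega)) ?_ ?_
    · rw [hadd]
      exact h.natCast_mul_κ_notMem (by omega)
    · rw [hsub]
      exact h.natCast_mul_κ_notMem (by omega)
  have hrec {n : ℕ} (hn : n ≠ 0) : 3 * (L.PhiFun ω ((n + 2 : ℕ) * κ) * L.PhiFun ω (n * κ) *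
      (2 - L.somosX ω ((n + 1 : ℕ) * κ))) =
        ((√6 : ℝ) : ℂ) * (L.somosX ω ((n + 1 : ℕ) * κ) + 1) := by
    have := h.PhiFun_add_mul_PhiFun_sub_κ (h.natCast_mul_κ_notMem (n := n + 1) (by omega))
      (hX0 (by omega)) (by rw [hadd]; exact h.natCast_mul_κ_notMem (by omega))
      (by rw [hsub]; exact h.natCast_mul_κ_notMem hn)
    rwa [hadd, hsub] at this
  constructor
  · simp [hκ0]
  · simp [h2κ0]
  · intro n hn hn2
    simp only [hn, if_true]
    rw [heven (by omega)]
    exact hne2 hn2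
  · intro n hn hn2 h0
    simp only [Nat.not_even_iff_odd.mpr hn, if_false] at h0
    refine hne2 hn2 ?_
    rw [← hodd (by omega), h0, mul_one]
  · intro n hn
    have e1 : Even (n + 1) := hn.add_one
    have e2 : ¬ Even (n + 2) := by grind
    have e0 : ¬ Even n := by grind
    simp only [e0, e1, e2, if_true, if_false]
    rw [heven (by omega)]
    have := hrec (n := n) (by grind)
    have hx2 : 2 - L.somosX ω ((n + 1 : ℕ) * κ) ≠ 0 := sub_ne_zero.mpr (hne2 (by grind)).symm
    generalize L.somosX ω ((n + 1 : ℕ) * κ) = x at this hx2 ⊢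
    generalize L.PhiFun ω ((n + 2 : ℕ) * κ) = A at this ⊢
    generalize L.PhiFun ω (n * κ) = B at this ⊢
    field_simp
    refine mul_left_cancel₀ hs0 ?_
    linear_combination ((√6 : ℝ) : ℂ) / 3 * this + (x + 1) / 3 * hs - (x + 1) * hκ
  · intro n hn hn2
    have e1 : ¬ Even (n + 1) := by grind
    have e2 : Even (n + 2) := by grind
    simp only [hn, e1, e2, if_true, if_false]
    have h1 := hodd (n := n + 1) (by omega)
    have := hrec (n := n) (by omega)
    rw [← h1] at this
    generalize (L.PhiFun ω ((n + 1 : ℕ) * κ) / L.PhiFun ω κ) ^ 2 = y at this ⊢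
    generalize L.PhiFun ω ((n + 2 : ℕ) * κ) = A at this ⊢
    generalize L.PhiFun ω (n * κ) = B at this ⊢
    field_simp
    refine mul_left_cancel₀ hs0 ?_
    linear_combination ((√6 : ℝ) : ℂ) / 6 * this + (2 * y + 1) / 6 * hs - (2 * y + 1) * h2κ

end IsSomosLattice

/-! ### Extension of the relations to all integer indices. -/

theorem somosStep_somosCurveRel (n : ℕ) :
    SomosStep n ∧ SomosCurveRel n ∧ somosTNat (n + 1) ≠ 0 := by
  obtain ⟨L, ω, κ, h⟩ := PeriodPair.exists_isSomosLattice
  obtain ⟨h1, h2, h3, -⟩ := h.isSomosRatio.somos n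
  exact ⟨h1, h2, h3⟩

lemma somosS_natCast (n : ℕ) : somosS n = somosSNat n := rfl

lemma somosT_natCast (n : ℕ) : somosT n = somosTNat n := by
  rcases n with _ | n
  · simp [somosT, somosTNat]
  · simp [somosT, Int.sign_eq_one_of_pos (show (0 : ℤ) < (n : ℤ) + 1 by omega),
      show ((n : ℤ) + 1).natAbs = n + 1 by omega]

lemma somosS_neg (n : ℤ) : somosS (-n) = somosS n := by
  simp [somosS]

lemma somosT_neg (n : ℤ) : somosT (-n) = -somosT n := by
  simp [somosT]

lemma somosS_pos (n : ℤ) : 0 < somosS n := somosSNat_pos _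

lemma somosS_ne_zero (n : ℤ) : somosS n ≠ 0 := (somosS_pos n).ne'

lemma somosT_zero : somosT 0 = 0 := by simp [somosT]

lemma somosT_ne_zero {n : ℤ} (hn : n ≠ 0) : somosT n ≠ 0 := by
  obtain ⟨m, hm⟩ : ∃ m : ℕ, n.natAbs = m + 1 := ⟨n.natAbs - 1, by omega⟩
  rw [somosT, hm]
  exact mul_ne_zero (by simpa using hn) (somosStep_somosCurveRel m).2.2

lemma somosS_zero : somosS 0 = 1 := rfl
lemma somosS_one : somosS 1 = 1 := rfl
lemma somosS_two : somosS 2 = 1 := rfl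
lemma somosT_one : somosT 1 = 1 := by simp [somosT, somosTNat]
lemma somosT_two : somosT 2 = -1 := by
  rw [show (2 : ℤ) = (2 : ℕ) from rfl, somosT_natCast, somosTNat]

lemma somos_evenStep {n : ℤ} (hn : Even n) : EvenStep (somosS (n - 1)) (somosT (n - 1))
    (somosS n) (somosT n) (somosS (n + 1)) (somosT (n + 1)) := by
  have key (m : ℕ) (hm : Odd m) : EvenStep (somosS m) (somosT m) (somosS (m + 1 : ℕ))
      (somosT (m + 1 : ℕ)) (somosS (m + 2 : ℕ)) (somosT (m + 2 : ℕ)) := by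
    simp only [somosS_natCast, somosT_natCast]
    exact (somosStep_somosCurveRel m).1.1 hm
  rcases lt_trichotomy n 0 with h | rfl | h
  · obtain ⟨m, hm⟩ : ∃ m : ℕ, n = -(m + 1 : ℕ) := ⟨(-n - 1).toNat, by omega⟩
    have := (key m (by grind)).symm
    rw [hm, show -((m + 1 : ℕ) : ℤ) - 1 = -(m + 2 : ℕ) by push_cast; ring,
      show -((m + 1 : ℕ) : ℤ) + 1 = -(m : ℤ) by push_cast; ring]
    simp only [somosS_neg, somosT_neg, EvenStep, neg_mul_neg, neg_sq]
    exact this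
  -- The step centred at 0 joins the two halves and is checked by hand; negative indices follow by
  -- reflection, as S is even and T is odd.
  · rw [zero_sub, zero_add, somosS_neg, somosT_neg, somosS_zero, somosS_one, somosT_zero,
      somosT_one]
    constructor <;> norm_num
  · obtain ⟨m, hm⟩ : ∃ m : ℕ, n = (m + 1 : ℕ) := ⟨(n - 1).toNat, by omega⟩
    have := key m (by grind)
    rwa [hm, show ((m + 1 : ℕ) : ℤ) - 1 = m by push_cast; ring,
      show ((m + 1 : ℕ) : ℤ) + 1 = (m + 2 : ℕ) by push_cast; ring]

lemma somos_oddStep {n : ℤ} (hn : Odd n) : OddStep (somosS (n - 1)) (somosT (n - 1))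
    (somosS n) (somosT n) (somosS (n + 1)) (somosT (n + 1)) := by
  have key (m : ℕ) (hm : Even m) : OddStep (somosS m) (somosT m) (somosS (m + 1 : ℕ))
      (somosT (m + 1 : ℕ)) (somosS (m + 2 : ℕ)) (somosT (m + 2 : ℕ)) := by
    simp only [somosS_natCast, somosT_natCast]
    exact (somosStep_somosCurveRel m).1.2 hm
  rcases lt_or_ge n 0 with h | h
  · obtain ⟨m, hm⟩ : ∃ m : ℕ, n = -(m + 1 : ℕ) := ⟨(-n - 1).toNat, by omega⟩
    have := (key m (by grind)).symm
    rw [hm, show -((m + 1 : ℕ) : ℤ) - 1 = -(m + 2 : ℕ) by push_cast; ring,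
      show -((m + 1 : ℕ) : ℤ) + 1 = -(m : ℤ) by push_cast; ring]
    simp only [somosS_neg, somosT_neg, OddStep, neg_mul_neg, neg_sq]
    exact this
  · obtain ⟨m, hm⟩ : ∃ m : ℕ, n = (m + 1 : ℕ) := ⟨(n - 1).toNat, by grind⟩
    have := key m (by grind)
    rwa [hm, show ((m + 1 : ℕ) : ℤ) - 1 = m by push_cast; ring,
      show ((m + 1 : ℕ) : ℤ) + 1 = (m + 2 : ℕ) by push_cast; ring]

lemma CurveRel.neg {𝕜 : Type*} [Field 𝕜] {a b c d : 𝕜} (h : CurveRel a b c d) :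
    CurveRel a (-b) c (-d) := by
  rw [CurveRel] at h ⊢
  linear_combination h

lemma somos_curveRel {n : ℤ} (hn : Even n) :
    CurveRel (somosS n) (somosT n) (somosS (n + 1)) (somosT (n + 1)) ∧
      CurveRel (somosS n) (somosT n) (somosS (n - 1)) (somosT (n - 1)) := by
  have succ (m : ℕ) (hm : Even m) :
      CurveRel (somosS m) (somosT m) (somosS (m + 1 : ℕ)) (somosT (m + 1 : ℕ)) := by
    simp only [somosS_natCast, somosT_natCast]
    exact (somosStep_somosCurveRel m).2.1.1 hm
  have pred (m : ℕ) (hm : Odd m) :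
      CurveRel (somosS (m + 1 : ℕ)) (somosT (m + 1 : ℕ)) (somosS m) (somosT m) := by
    simp only [somosS_natCast, somosT_natCast]
    exact (somosStep_somosCurveRel m).2.1.2 hm
  have h0 : CurveRel (somosS 0) (somosT 0) (somosS 1) (somosT 1) := succ 0 (by decide)
  rcases lt_trichotomy n 0 with h | rfl | h
  · obtain ⟨m, hm⟩ : ∃ m : ℕ, n = -(m + 1 : ℕ) := ⟨(-n - 1).toNat, by omega⟩
    rw [hm, show -((m + 1 : ℕ) : ℤ) - 1 = -(m + 2 : ℕ) by push_cast; ring,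
      show -((m + 1 : ℕ) : ℤ) + 1 = -(m : ℤ) by push_cast; ring]
    simp only [somosS_neg, somosT_neg]
    exact ⟨(pred m (by grind)).neg, (succ (m + 1) (by grind)).neg⟩
  · rw [zero_sub, zero_add, somosS_neg, somosT_neg]
    refine ⟨h0, ?_⟩
    have := h0.neg
    rwa [somosT_zero, neg_zero, ← somosT_zero] at this
  · obtain ⟨m, hm⟩ : ∃ m : ℕ, n = (m + 1 : ℕ) := ⟨(n - 1).toNat, by omega⟩
    rw [hm, show ((m + 1 : ℕ) : ℤ) - 1 = m by push_cast; ring,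
      show ((m + 1 : ℕ) : ℤ) + 1 = (m + 2 : ℕ) by push_cast; ring]
    exact ⟨succ (m + 1) (by grind), pred m (by grind)⟩

lemma somos_even_cross {n : ℤ} (hn : Even n) : somosS (n + 1) * somosT (n - 1) +
    somosS (n - 1) * somosT (n + 1) + 3 * (somosS n * somosT n) = 0 :=
  (somos_evenStep hn).cross (somos_curveRel hn).2 (somosS_ne_zero _) (somosT_ne_zero (by grind))

lemma somos_odd_cross {n : ℤ} (hn : Odd n) : somosS (n + 1) * somosT (n - 1) +
    somosS (n - 1) * somosT (n + 1) + somosS n * somosT n = 0 := by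
  by_cases h : n = 1
  -- Here T at n − 1 is T₀ = 0, so the division in `OddStep.cross` is unavailable.
  · subst h
    norm_num [somosS_zero, somosT_zero, somosS_one, somosT_one, somosS_two, somosT_two]
  · have hK := (somos_curveRel (n := n - 1) (by grind)).1
    rw [sub_add_cancel] at hK
    exact (somos_oddStep hn).cross hK (somosS_ne_zero _) (somosT_ne_zero (by grind))

lemma two_mul_somosT_sq_sub_ne_zero {n : ℤ} (hn : Even n) :
    2 * somosT n ^ 2 - somosS n ^ 2 ≠ 0 := by
  rw [← (somos_evenStep hn).2]
  exact mul_ne_zero (somosT_ne_zero (by grind)) (somosT_ne_zero (by grind))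

lemma somosT_sq_sub_ne_zero {n : ℤ} (hn : Odd n) (h1 : n ≠ 1) (h2 : n ≠ -1) :
    somosT n ^ 2 - somosS n ^ 2 ≠ 0 := by
  rw [← (somos_oddStep hn).2]
  exact mul_ne_zero three_ne_zero
    (mul_ne_zero (somosT_ne_zero (by grind)) (somosT_ne_zero (by grind)))

/-! ### The rational ratios: recurrence and biquadratic curve. -/

lemma two_sub_somosRatio_sq_ne_zero {n : ℤ} (hn : Even n) (h0 : n ≠ 0) :
    2 - somosRatio n ^ 2 ≠ 0 := by
  have hT := somosT_ne_zero h0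
  intro h
  refine two_mul_somosT_sq_sub_ne_zero hn ?_
  rw [somosRatio] at h
  field_simp at h
  linear_combination h

lemma one_sub_somosRatio_sq_ne_zero {n : ℤ} (hn : Odd n) (h1 : n ≠ 1) (h2 : n ≠ -1) :
    1 - somosRatio n ^ 2 ≠ 0 := by
  have hT := somosT_ne_zero (n := n) (by grind)
  intro h
  refine somosT_sq_sub_ne_zero hn h1 h2 ?_
  rw [somosRatio] at h
  field_simp at h
  linear_combination h

lemma somosRatio_even_mul {n : ℤ} (hn : Even n) (h0 : n ≠ 0) :
    somosRatio (n + 1) * somosRatio (n - 1) =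
      (1 + somosRatio n ^ 2) / (2 - somosRatio n ^ 2) := by
  have hT := somosT_ne_zero h0
  have hT1 := somosT_ne_zero (n := n + 1) (by grind)
  have hT2 := somosT_ne_zero (n := n - 1) (by grind)
  obtain ⟨h1, h2⟩ := somos_evenStep hn
  rw [eq_div_iff (two_sub_somosRatio_sq_ne_zero hn h0)]
  simp only [somosRatio]
  field_simp
  linear_combination (2 * somosT n ^ 2 - somosS n ^ 2) * h1 -
    (somosS n ^ 2 + somosT n ^ 2) * h2

lemma somosRatio_odd_mul {n : ℤ} (hn : Odd n) (h1 : n ≠ 1) (h2 : n ≠ -1) :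
    somosRatio (n + 1) * somosRatio (n - 1) =
      (1 + 2 * somosRatio n ^ 2) / (1 - somosRatio n ^ 2) := by
  have hT := somosT_ne_zero (n := n) (by grind)
  have hT1 := somosT_ne_zero (n := n + 1) (by grind)
  have hT2 := somosT_ne_zero (n := n - 1) (by grind)
  obtain ⟨h3, h4⟩ := somos_oddStep hn
  rw [eq_div_iff (one_sub_somosRatio_sq_ne_zero hn h1 h2)]
  simp only [somosRatio]
  field_simp
  linear_combination ((somosT n ^ 2 - somosS n ^ 2) * h3 -
    (2 * somosS n ^ 2 + somosT n ^ 2) * h4) / 3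

/-- The sum of the roots in affine form, which is how `otherRoot` computes the horizontal switch. -/
lemma somosRatio_even_add {n : ℤ} (hn : Even n) (h0 : n ≠ 0) :
    somosRatio (n + 1) = -(3 * somosRatio n) / (2 - somosRatio n ^ 2) - somosRatio (n - 1) := by
  have hT := somosT_ne_zero h0
  have hT1 := somosT_ne_zero (n := n + 1) (by grind)
  have hT2 := somosT_ne_zero (n := n - 1) (by grind)
  have h2 := (somos_evenStep hn).2
  have h3 := somos_even_cross hn
  rw [eq_sub_iff_add_eq, eq_div_iff (two_sub_somosRatio_sq_ne_zero hn h0)]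
  simp only [somosRatio]
  field_simp
  linear_combination (2 * somosT n ^ 2 - somosS n ^ 2) * h3 + 3 * somosS n * somosT n * h2

lemma somosRatio_odd_add {n : ℤ} (hn : Odd n) (h1 : n ≠ 1) (h2 : n ≠ -1) :
    somosRatio (n + 1) = -(3 * somosRatio n) / (1 - somosRatio n ^ 2) - somosRatio (n - 1) := by
  have hT := somosT_ne_zero (n := n) (by grind)
  have hT1 := somosT_ne_zero (n := n + 1) (by grind)
  have hT2 := somosT_ne_zero (n := n - 1) (by grind)
  have h3 := (somos_oddStep hn).2
  have h4 := somos_odd_cross hn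
  rw [eq_sub_iff_add_eq, eq_div_iff (one_sub_somosRatio_sq_ne_zero hn h1 h2)]
  simp only [somosRatio]
  field_simp
  linear_combination (somosT n ^ 2 - somosS n ^ 2) * h4 + somosS n * somosT n * h3

lemma somosRatio_curve {n m : ℤ} (hn : n ≠ 0) (hm : m ≠ 0)
    (h : CurveRel (somosS n) (somosT n) (somosS m) (somosT m)) :
    (1 - somosRatio m ^ 2) * somosRatio n ^ 2 + 3 * somosRatio m * somosRatio n +
      2 * somosRatio m ^ 2 + 1 = 0 := by
  have hn' := somosT_ne_zero hn
  have hm' := somosT_ne_zero hm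
  rw [CurveRel] at h
  simp only [somosRatio]
  field_simp
  linear_combination h

lemma somosRatio_neg (n : ℤ) : somosRatio (-n) = -somosRatio n := by
  rw [somosRatio, somosS_neg, somosT_neg, div_neg, somosRatio]

/-! ### Points of the projective line and the QRT switches. -/

lemma somosRatioP_zero : somosRatioP 0 = OnePoint.infty := by
  rw [somosRatioP, if_pos somosT_zero]

lemma somosRatioP_eq_coe {n : ℤ} (hn : n ≠ 0) :
    somosRatioP n = ((somosRatio n : ℚ) : OnePoint ℚ) := by
  rw [somosRatioP, if_neg (somosT_ne_zero hn), somosRatio]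

lemma projCoords_infty : projCoords OnePoint.infty = (1, 0) := rfl

lemma projCoords_coe (x : ℚ) : projCoords (x : OnePoint ℚ) = (x, 1) := rfl

lemma otherRoot_infty {A B C : ℚ} (hB : B ≠ 0) :
    otherRoot A B C OnePoint.infty = ((-C / B : ℚ) : OnePoint ℚ) := if_neg hB

lemma otherRoot_coe {A B C : ℚ} (hA : A ≠ 0) (x : ℚ) :
    otherRoot A B C (x : OnePoint ℚ) = ((-B / A - x : ℚ) : OnePoint ℚ) := if_neg hA

lemma otherRoot_coe_of_eq_zero {A B C : ℚ} (hA : A = 0) (x : ℚ) :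
    otherRoot A B C (x : OnePoint ℚ) = OnePoint.infty := if_pos hA

lemma somosRatio_one : somosRatio 1 = 1 := by
  rw [somosRatio, somosS_one, somosT_one, div_one]

lemma somosRatio_two : somosRatio 2 = -1 := by
  rw [somosRatio, somosS_two, somosT_two]
  norm_num

lemma onBiquadratic_somosRatioP {n m : ℤ} (hm : m ≠ 0)
    (h : CurveRel (somosS n) (somosT n) (somosS m) (somosT m)) :
    OnBiquadratic 3 (somosRatioP m, somosRatioP n) := by
  have hm' := somosT_ne_zero hm
  rw [OnBiquadratic, somosRatioP_eq_coe hm]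
  by_cases hn : n = 0
  · subst hn
    rw [CurveRel, somosS_zero, somosT_zero] at h
    rw [somosRatioP_zero, projCoords_infty, projCoords_coe, somosRatio]
    field_simp
    linear_combination h
  · rw [somosRatioP_eq_coe hn, projCoords_coe, projCoords_coe]
    linear_combination somosRatio_curve hn hm h

lemma switchH_somosRatioP {n : ℤ} (hn : Even n) :
    switchH 3 (somosRatioP (n - 1), somosRatioP n) = (somosRatioP (n + 1), somosRatioP n) := by
  rw [switchH, Prod.mk.injEq]
  refine ⟨?_, rfl⟩
  rw [somosRatioP_eq_coe (n := n - 1) (by grind), somosRatioP_eq_coe (n := n + 1) (by grind)]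
  by_cases h0 : n = 0
  -- On the line Z = ∞ the quadratic in W is −W² + 1, so the switch exchanges −1 and 1.
  · subst h0
    simp only [somosRatioP_zero, projCoords_infty]
    rw [otherRoot_coe (by norm_num), zero_sub, zero_add, somosRatio_neg, somosRatio_one]
    norm_num
  · simp only [somosRatioP_eq_coe h0, projCoords_coe, mul_one, one_pow]
    rw [otherRoot_coe (two_sub_somosRatio_sq_ne_zero hn h0), somosRatio_even_add hn h0]

lemma switchV_somosRatioP {n : ℤ} (hn : Odd n) :
    switchV 3 (somosRatioP n, somosRatioP (n - 1)) = (somosRatioP n, somosRatioP (n + 1)) := by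
  rw [switchV, Prod.mk.injEq]
  refine ⟨rfl, ?_⟩
  simp only [somosRatioP_eq_coe (n := n) (by grind), projCoords_coe, mul_one, one_pow]
  by_cases h1 : n = 1
  -- For W = ±1 the leading coefficient in Z vanishes: one root is ∞ and the other is finite. At n =
  -- 1 the switch leaves ∞ and reaches −1.
  · subst h1
    rw [sub_self, somosRatioP_zero, somosRatio_one, otherRoot_infty (by norm_num),
      show (1 : ℤ) + 1 = 2 from rfl, somosRatioP_eq_coe two_ne_zero, somosRatio_two]
    norm_num
  by_cases h2 : n = -1
  -- At n = −1 the switch goes from the finite root to ∞.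
  · subst h2
    rw [neg_add_cancel, somosRatioP_zero, somosRatioP_eq_coe (by norm_num), somosRatio_neg,
      somosRatio_one, otherRoot_coe_of_eq_zero (by norm_num)]
  · rw [somosRatioP_eq_coe (n := n - 1) (by grind), somosRatioP_eq_coe (n := n + 1) (by grind),
      otherRoot_coe (one_sub_somosRatio_sq_ne_zero hn h1 h2), somosRatio_odd_add hn h1 h2]

/-- Positive indices come from the induction; negative ones follow because both Φ and the ratio are
odd. -/
lemma IsSomosLattice.somosRatio_eq {L : PeriodPair} {ω κ : ℂ} (h : IsSomosLattice L ω κ) {n : ℤ}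
    (hn : n ≠ 0) :
    (Even n → (somosRatio n : ℂ) = -(L.PhiFun ω (n * κ) / L.PhiFun ω (2 * κ))) ∧
      (Odd n → (somosRatio n : ℂ) = L.PhiFun ω (n * κ) / L.PhiFun ω κ) := by
  have key (m : ℕ) : (somosRatio (m + 1 : ℕ) : ℂ) = if Even (m + 1) then
      -(L.PhiFun ω ((m + 1 : ℕ) * κ) / L.PhiFun ω (2 * κ)) else
        L.PhiFun ω ((m + 1 : ℕ) * κ) / L.PhiFun ω κ := by
    rw [← (h.isSomosRatio.somos m).2.2.2, somosRatio, somosS_natCast, somosT_natCast]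
    push_cast
    rfl
  rcases lt_or_gt_of_ne hn with h0 | h0
  · obtain ⟨m, hm⟩ : ∃ m : ℕ, n = -(m + 1 : ℕ) := ⟨(-n - 1).toNat, by omega⟩
    have hΦ : L.PhiFun ω (n * κ) = -L.PhiFun ω ((m + 1 : ℕ) * κ) := by
      rw [hm, ← PeriodPair.PhiFun_neg h.ω_notMem h.two_mul_ω_mem]
      congr 1
      push_cast
      ring
    rw [hΦ, hm, somosRatio_neg, Rat.cast_neg, key]
    refine ⟨fun he ↦ ?_, fun ho ↦ ?_⟩
    · rw [if_pos (by grind)]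
      ring
    · rw [if_neg (by grind)]
      ring
  · obtain ⟨m, hm⟩ : ∃ m : ℕ, n = (m + 1 : ℕ) := ⟨(n - 1).toNat, by omega⟩
    rw [hm, key]
    refine ⟨fun he ↦ ?_, fun ho ↦ ?_⟩
    · rw [if_pos (by grind), Int.cast_natCast]
    · rw [if_neg (by grind), Int.cast_natCast]

theorem proposition2p7 :
    -- every ratio `f n` with `n ≠ 0` is finite, and `f 0 = ∞`
    ((∀ n : ℤ, n ≠ 0 → somosT n ≠ 0) ∧ somosRatioP 0 = OnePoint.infty) ∧
    -- the analytic formula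
    (∃ (L : PeriodPair) (ω κ : ℂ), IsSomosLattice L ω κ) ∧
    (∀ (L : PeriodPair) (ω κ : ℂ), IsSomosLattice L ω κ →
      Tendsto (L.PhiFun ω) (𝓝[≠] 0) (Bornology.cobounded ℂ) ∧
      L.PhiFun ω κ ≠ 0 ∧ L.PhiFun ω (2 * κ) ≠ 0 ∧
      ∀ n : ℤ, n ≠ 0 → (n : ℂ) * κ ∉ L.lattice ∧
        (Even n → (somosRatio n : ℂ) = -(L.PhiFun ω (n * κ) / L.PhiFun ω (2 * κ))) ∧
        (Odd n → (somosRatio n : ℂ) = L.PhiFun ω (n * κ) / L.PhiFun ω κ)) ∧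
    -- the recurrence, where all terms are finite
    (∀ n : ℤ, Even n → n ≠ 0 → 2 - somosRatio n ^ 2 ≠ 0 ∧
      somosRatio (n + 1) * somosRatio (n - 1)
        = (1 + somosRatio n ^ 2) / (2 - somosRatio n ^ 2)) ∧
    (∀ n : ℤ, Odd n → n ≠ 1 → n ≠ -1 → 1 - somosRatio n ^ 2 ≠ 0 ∧
      somosRatio (n + 1) * somosRatio (n - 1)
        = (1 + 2 * somosRatio n ^ 2) / (1 - somosRatio n ^ 2)) ∧
    -- the recurrence in the projective line, for every `n`
    (∀ n : ℤ, Even n →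
      SameProjPoint (somosS (n + 1) * somosS (n - 1)) (somosT (n + 1) * somosT (n - 1))
        (somosT n ^ 2 + somosS n ^ 2) (2 * somosT n ^ 2 - somosS n ^ 2)) ∧
    (∀ n : ℤ, Odd n →
      SameProjPoint (somosS (n + 1) * somosS (n - 1)) (somosT (n + 1) * somosT (n - 1))
        (somosT n ^ 2 + 2 * somosS n ^ 2) (somosT n ^ 2 - somosS n ^ 2)) ∧
    -- the points `(f (2j ± 1), f (2j))` lie on the curve: affine for `j ≠ 0`, projective for all `j`
    (∀ j : ℤ, j ≠ 0 → ∀ W Z : ℚ, (W = somosRatio (2 * j + 1) ∨ W = somosRatio (2 * j - 1)) →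
      Z = somosRatio (2 * j) → (1 - W ^ 2) * Z ^ 2 + 3 * W * Z + 2 * W ^ 2 + 1 = 0) ∧
    (∀ j : ℤ, OnBiquadratic 3 (somosRatioP (2 * j + 1), somosRatioP (2 * j)) ∧
      OnBiquadratic 3 (somosRatioP (2 * j - 1), somosRatioP (2 * j))) ∧
    -- they form an orbit of the QRT map and of the two switches that compose it
    (∀ j : ℤ,
      switchH 3 (somosRatioP (2 * j - 1), somosRatioP (2 * j))
        = (somosRatioP (2 * j + 1), somosRatioP (2 * j)) ∧
      switchV 3 (somosRatioP (2 * j + 1), somosRatioP (2 * j))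
        = (somosRatioP (2 * j + 1), somosRatioP (2 * j + 2)) ∧
      qrtMap 3 (somosRatioP (2 * j - 1), somosRatioP (2 * j))
        = (somosRatioP (2 * j + 1), somosRatioP (2 * j + 2))) := by
  have hSS (n : ℤ) : somosS (n + 1) * somosS (n - 1) ≠ 0 :=
    mul_ne_zero (somosS_ne_zero _) (somosS_ne_zero _)
  have hH (j : ℤ) : switchH 3 (somosRatioP (2 * j - 1), somosRatioP (2 * j)) =
      (somosRatioP (2 * j + 1), somosRatioP (2 * j)) := switchH_somosRatioP (even_two_mul j)
  have hV (j : ℤ) : switchV 3 (somosRatioP (2 * j + 1), somosRatioP (2 * j)) =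
      (somosRatioP (2 * j + 1), somosRatioP (2 * j + 2)) := by
    have := switchV_somosRatioP (n := 2 * j + 1) (odd_two_mul_add_one j)
    rwa [add_sub_cancel_right, add_assoc, one_add_one_eq_two] at this
  refine ⟨⟨fun n hn ↦ somosT_ne_zero hn, somosRatioP_zero⟩, PeriodPair.exists_isSomosLattice,
    fun L ω κ h ↦ ⟨PeriodPair.tendsto_PhiFun_cobounded h.ω_notMem, ?_, ?_, fun n hn ↦
      ⟨h.mul_κ_notMem hn, h.somosRatio_eq hn⟩⟩,
    fun n hn h0 ↦ ⟨two_sub_somosRatio_sq_ne_zero hn h0, somosRatio_even_mul hn h0⟩,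
    fun n hn h1 h2 ↦ ⟨one_sub_somosRatio_sq_ne_zero hn h1 h2, somosRatio_odd_mul hn h1 h2⟩,
    fun n hn ↦ ⟨Or.inl (hSS n), Or.inl ?_, ?_⟩, fun n hn ↦ ⟨Or.inl (hSS n), Or.inl ?_, ?_⟩,
    ?_, fun j ↦ ⟨?_, ?_⟩, fun j ↦ ⟨hH j, hV j, by rw [qrtMap, hH, hV]⟩⟩
  · simpa using h.PhiFun_mul_κ_ne_zero one_ne_zero
  · simpa using h.PhiFun_mul_κ_ne_zero two_ne_zero
  · have := somosS_pos n
    positivity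
  · obtain ⟨h1, h2⟩ := somos_evenStep hn
    linear_combination (2 * somosT n ^ 2 - somosS n ^ 2) * h1 -
      (somosS n ^ 2 + somosT n ^ 2) * h2
  · have := somosS_pos n
    positivity
  · obtain ⟨h1, h2⟩ := somos_oddStep hn
    linear_combination ((somosT n ^ 2 - somosS n ^ 2) * h1 -
      (2 * somosS n ^ 2 + somosT n ^ 2) * h2) / 3
  · rintro j hj W Z (rfl | rfl) rfl
    · exact somosRatio_curve (by omega) (by omega) (somos_curveRel (even_two_mul j)).1
    · exact somosRatio_curve (by omega) (by omega) (somos_curveRel (even_two_mul j)).2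
  · exact onBiquadratic_somosRatioP (by omega) (somos_curveRel (even_two_mul j)).1
  · exact onBiquadratic_somosRatioP (by omega) (somos_curveRel (even_two_mul j)).2
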